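/- Let $\mathbb T=\mathbb R/\mathbb Z$ with its usual distance $|x-y|$. For a complex Borel measure $\mu$ on $\mathbb T$ let $|\mu|$ be its variation, $\|\mu\|=|\mu|(\mathbb T)$, $\hat\mu(m)=\int_{\mathbb T}e^{-2\pi imx}\,d\mu(x)$, and $P_M\mu(x)=\sum_{m=-M}^{M}\hat\mu(m)e^{2\pi imx}$. For $\epsilon\in\mathbb R$, say that $\mu$ is an $(\epsilon,\Lambda_M)$-approximation of $\mu_0$ if $\|\mu\|\le\|\mu_0\|+2\epsilon$ and $\|P_M(\mu-\mu_0)\|_{L^2(\mathbb T)}\le 2\epsilon$. There exists an absolute constant $C>0$ such that the following holds. Let $M\ge 128$ be an integer, let $\mu_0$ be a discrete complex measure on $\mathbb T$ whose support $S=\{s_j\}_{j=1}^J$ satisfies $|s_j-s_k|\ge 2/M$ for all $j\ne k$, and let $\mu$ be a complex measure on $\mathbb T$ that is an $(\epsilon,\Lambda_M)$-approximation of $\mu_0$. Put $S_M(j)=\{x\in\mathbb T:|x-s_j|\le 0.16\,M^{-1}\}$ and $S_M=\bigcup_{j=1}^J S_M(j)$. Then $$\int_{\mathbb T\setminus S_M}d|\mu-\mu_0|\le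 C\epsilon\qquad\text{and}\qquad \sum_{j=1}^J\int_{S_M(j)}|x-s_j|^2\,d|\mu-\mu_0|(x)\le C M^{-2}\epsilon.$$ -/

import Mathlib

open MeasureTheory

noncomputable section

namespace SuperResolution

/-- The torus `𝕋 = ℝ/ℤ`, with its quotient metric `dist x y = min_{k ∈ ℤ} |x - y - k|`. -/
abbrev Torus : Type := UnitAddCircle

/-- A complex measure has finite total variation, so the real-valued quantities below that are
built from `μ.variation` are the genuine ones. -/
instance isFiniteMeasure_variation {X : Type*} [MeasurableSpace X] (μ : ComplexMeasure X) :
    IsFiniteMeasure μ.variation := by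
  have hfin : ∀ σ : SignedMeasure X, IsFiniteMeasure σ.variation := fun σ => by
    rw [← SignedMeasure.totalVariation_eq_variation]
    unfold SignedMeasure.totalVariation
    infer_instance
  have h1 := hfin (ComplexMeasure.re μ)
  have h2 := hfin (ComplexMeasure.im μ)
  refine isFiniteMeasure_of_le
    ((ComplexMeasure.re μ).variation + (ComplexMeasure.im μ).variation) ?_
  refine VectorMeasure.variation_le_of_forall_enorm_le fun E _ => ?_
  rw [Measure.add_apply]
  refine le_trans ?_ (add_le_add
    (VectorMeasure.enorm_measure_le_variation (ComplexMeasure.re μ) E)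
    (VectorMeasure.enorm_measure_le_variation (ComplexMeasure.im μ) E))
  rw [← ofReal_norm, ← ofReal_norm, ← ofReal_norm,
    ← ENNReal.ofReal_add (norm_nonneg _) (norm_nonneg _)]
  exact ENNReal.ofReal_le_ofReal (Complex.norm_le_abs_re_add_abs_im (μ E))

/-- The total variation norm `‖μ‖ = |μ|(𝕋)`. -/
def tvNorm (μ : ComplexMeasure Torus) : ℝ := μ.variation.real Set.univ

/-- The Fourier coefficient `μ̂(m) = ∫ e^{-2πimx} dμ(x)`. -/
def fourierCoeff (μ : ComplexMeasure Torus) (m : ℤ) : ℂ :=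
  VectorMeasure.integral μ (fun x : Torus => (fourier (-m) x : ℂ)) (ContinuousLinearMap.mul ℝ ℂ)

/-- The projection `P_M μ (x) = ∑_{m=-M}^{M} μ̂(m) e^{2πimx}`. -/
def proj (M : ℕ) (μ : ComplexMeasure Torus) (x : Torus) : ℂ :=
  ∑ m ∈ Finset.Icc (-(M : ℤ)) (M : ℤ), fourierCoeff μ m * fourier m x

/-- The norm of `L²(𝕋)`, with respect to the Haar probability measure. -/
def l2Norm (f : Torus → ℂ) : ℝ := (eLpNorm f 2 AddCircle.haarAddCircle).toReal

/-- The (closed) support of a complex measure: the complement of the largest open `|μ|`-null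
set. -/
def support (μ : ComplexMeasure Torus) : Set Torus := μ.variation.support

/-- Discrete measures: those carried by a countable set, i.e. the sums of countably many point
masses. -/
def IsDiscrete (μ : ComplexMeasure Torus) : Prop :=
  ∃ D : Set Torus, D.Countable ∧ μ.variation Dᶜ = 0

/-- The `Λ_M`-minimum separation condition: distinct points are at distance at least `2/M`. -/
def IsMinSeparated (M : ℕ) (S : Set Torus) : Prop :=
  ∀ s ∈ S, ∀ t ∈ S, s ≠ t → 2 / (M : ℝ) ≤ dist s t

/-- The class `M(𝕋; Λ_M)` of discrete measures whose support satisfies the `Λ_M`-minimum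
separation condition. -/
def separatedMeasures (M : ℕ) : Set (ComplexMeasure Torus) :=
  {μ | IsDiscrete μ ∧ IsMinSeparated M (support μ)}

/-- `μ` is an `(ε, Λ_M)`-approximation of `μ₀`. -/
def IsApproximation (ε : ℝ) (M : ℕ) (μ μ₀ : ComplexMeasure Torus) : Prop :=
  tvNorm μ ≤ tvNorm μ₀ + 2 * ε ∧ l2Norm (proj M (μ - μ₀)) ≤ 2 * ε

/-- The neighbourhood `{x : |x - s| ≤ 0.16 / M}` of a point `s`. -/
def nearPoint (M : ℕ) (s : Torus) : Set Torus := {x | dist x s ≤ 0.16 / (M : ℝ)}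

/-- The union `S_M` of the neighbourhoods of the points of `S`. -/
def nearSet (M : ℕ) (S : Finset Torus) : Set Torus := ⋃ s ∈ S, nearPoint M s

end SuperResolution

end

/-!
Fix phases `v` on the support `S` of `μ₀`. Because `S` is separated, there is a trigonometric
polynomial `q` of degree at most `M` with `q = v` and `q' = 0` on `S`: one looks for `q` as a
combination of translates of a Jackson kernel (the square of a Fejér kernel) and of an odd
companion, whose fourth and third power decay makes the interpolation system diagonally dominant.
The same decay gives `|q| ≤ 1 - c (M · dist)²` near each point of `S` and `|q| ≤ 1 - c` elsewhere.

Take for `v` the conjugate phases of `μ - μ₀` on `S`. The pairing of `q` with `μ - μ₀` only sees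
frequencies up to `M`, so it is at most `2ε`; and as the total variation of `μ` exceeds that of
`μ₀` by at most `2ε`, the mass of `μ - μ₀` off `S` is at most its mass on `S` plus `2ε`. Together
these give `∫ (1 - |q|) d|μ - μ₀| ≤ 4ε`, which is both estimates at once.
-/

namespace SuperResolution

section ComplexMeasure

variable {X : Type*} [MeasurableSpace X]

/-- The integral `∫ f dν` of a complex function against a complex measure, with the pairing used
in `fourierCoeff`. -/
noncomputable abbrev cintegral (ν : ComplexMeasure X) (f : X → ℂ) : ℂ :=
  VectorMeasure.integral ν f (ContinuousLinearMap.mul ℝ ℂ)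

lemma cintegral_const_mul (ν : ComplexMeasure X) (c : ℂ) (f : X → ℂ) :
    cintegral ν (fun x => c * f x) = c * cintegral ν f := by
  refine setToFun_smul (𝕜 := ℂ) _ (fun c s x => ?_) c f
  simp only [transpose_eq_cbmApplyMeasure, cbmApplyMeasure_apply, ContinuousLinearMap.mul_apply',
    smul_eq_mul, mul_assoc]

lemma norm_cintegral_le (ν : ComplexMeasure X) (f : X → ℂ) :
    ‖cintegral ν f‖ ≤ ∫ x, ‖f x‖ ∂ν.variation :=
  VectorMeasure.norm_integral_le_integral_norm.trans <|
    mul_le_of_le_one_left (by positivity) (ContinuousLinearMap.opNorm_mul_le ℝ ℂ)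

/-- The cone condition: a measure of nearly minimal total variation deviates from `μ₀` off the
carrier of `μ₀` by little more than on it. -/
lemma variation_real_sub_compl_le {μ μ₀ : ComplexMeasure X} {S : Set X} {δ : ℝ}
    (hS : MeasurableSet S) (h₀ : μ₀.variation Sᶜ = 0)
    (h : μ.variation.real Set.univ ≤ μ₀.variation.real Set.univ + δ) :
    (μ - μ₀).variation.real Sᶜ ≤ (μ - μ₀).variation.real S + δ := by
  have sub_le (μ₁ μ₂ : ComplexMeasure X) (E : Set X) :
      (μ₁ - μ₂).variation.real E ≤ μ₁.variation.real E + μ₂.variation.real E := by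
    rw [← measureReal_add_apply]
    exact ENNReal.toReal_mono (by finiteness) (VectorMeasure.variation_sub_le _)
  have on_compl := sub_le μ μ₀ Sᶜ
  have on_carrier := sub_le μ (μ - μ₀) S
  rw [sub_sub_cancel] at on_carrier
  have h₀' : μ₀.variation.real Sᶜ = 0 := by rw [measureReal_def, h₀, ENNReal.toReal_zero]
  rw [← measureReal_add_measureReal_compl hS, ← measureReal_add_measureReal_compl hS] at h
  linarith

variable [MeasurableSingletonClass X]

lemma variation_singleton (ν : ComplexMeasure X) (x : X) : ν.variation {x} = ‖ν {x}‖ₑ := by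
  refine le_antisymm ?_ (VectorMeasure.enorm_measure_le_variation ν {x})
  have h := VectorMeasure.variation_apply_le_of_forall_enorm_le (μ := ν)
    (m := ‖ν {x}‖ₑ • Measure.dirac x) (measurableSet_singleton x) fun E _ hE => by
      rcases Set.subset_singleton_iff_eq.1 hE with rfl | rfl <;> simp
  simpa using h

lemma variation_real_finset (ν : ComplexMeasure X) (S : Finset X) :
    ν.variation.real (S : Set X) = ∑ s ∈ S, ‖ν {s}‖ := by
  simp only [measureReal_def, ← sum_measure_singleton, variation_singleton,
    ENNReal.toReal_sum (fun s _ => enorm_ne_top (x := ν {s})), toReal_enorm]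

lemma cintegral_restrict_finset {ν : ComplexMeasure X} {f : X → ℂ}
    (hf : Integrable f ν.variation) (S : Finset X) :
    cintegral (ν.restrict (S : Set X)) f = ∑ s ∈ S, f s * ν {s} := by
  have hS : (S : Set X) = ⋃ s ∈ S, {s} := by ext; simp
  rw [cintegral, hS, VectorMeasure.setIntegral_biUnion_finset S
    (fun s _ => measurableSet_singleton s)
    (fun s _ t _ hst => by simpa [Function.onFun] using hst)
    (fun s _ => VectorMeasure.Integrable.integrableOn hf)]
  refine Finset.sum_congr rfl fun s _ => ?_
  rw [VectorMeasure.setIntegral_congr_fun (g := fun _ => f s) (by rintro x rfl; rfl),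
    VectorMeasure.integral_const]
  simp

lemma variation_real_finset_le {ν : ComplexMeasure X} {q : X → ℂ}
    (hq : Integrable q ν.variation) {S : Finset X} (hphase : ∀ s ∈ S, q s * ν {s} = ‖ν {s}‖) :
    ν.variation.real (S : Set X) ≤
      ‖cintegral ν q‖ + ∫ x in (S : Set X)ᶜ, ‖q x‖ ∂ν.variation := by
  have on_S : ‖cintegral (ν.restrict (S : Set X)) q‖ = ν.variation.real (S : Set X) := by
    rw [cintegral_restrict_finset hq, Finset.sum_congr rfl hphase, ← Complex.ofReal_sum,
      ← variation_real_finset, Complex.norm_real, Real.norm_of_nonneg measureReal_nonneg]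
  have split : cintegral (ν.restrict (S : Set X)) q =
      cintegral ν q - cintegral (ν.restrict (S : Set X)ᶜ) q :=
    eq_sub_of_add_eq (VectorMeasure.setIntegral_add_compl S.measurableSet hq)
  have off_S := norm_cintegral_le (ν.restrict (S : Set X)ᶜ) q
  rw [VectorMeasure.variation_restrict S.measurableSet.compl] at off_S
  rw [← on_S, split]
  exact (norm_sub_le _ _).trans (by gcongr)

end ComplexMeasure

section TrigPoly

lemma integrable_of_continuous (ν : Measure Torus) [IsFiniteMeasure ν] {f : Torus → ℂ}
    (hf : Continuous f) : Integrable f ν :=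
  hf.integrable_of_hasCompactSupport (HasCompactSupport.of_compactSpace f)

/-- Trigonometric polynomials of degree at most `M`: the span of the characters of frequency
`|m| ≤ M`. -/
noncomputable def trigPoly (M : ℕ) : Submodule ℂ C(Torus, ℂ) :=
  Submodule.span ℂ (fourier '' Set.Icc (-(M : ℤ)) M)

lemma fourier_mem_trigPoly {M : ℕ} {m : ℤ} (hm : |m| ≤ M) : fourier m ∈ trigPoly M :=
  Submodule.subset_span ⟨m, abs_le.1 hm, rfl⟩

lemma trigPoly_mono : Monotone trigPoly := fun M K h =>
  Submodule.span_mono (Set.image_mono (Set.Icc_subset_Icc (by omega) (by omega)))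

lemma one_mem_trigPoly (M : ℕ) : 1 ∈ trigPoly M := by
  have h : (1 : C(Torus, ℂ)) = fourier 0 := by ext; simp
  exact h ▸ fourier_mem_trigPoly (by simp)

lemma mul_mem_trigPoly {M K : ℕ} {f g : C(Torus, ℂ)} (hf : f ∈ trigPoly M) (hg : g ∈ trigPoly K) :
    f * g ∈ trigPoly (M + K) := by
  have h := Submodule.mul_mem_mul hf hg
  rw [trigPoly, trigPoly, Submodule.span_mul_span] at h
  refine Submodule.span_mono ?_ h
  rintro _ ⟨_, ⟨m, hm, rfl⟩, _, ⟨k, hk, rfl⟩, rfl⟩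
  refine ⟨m + k, ?_, ?_⟩
  · simp only [Set.mem_Icc] at hm hk ⊢; omega
  · ext x; exact fourier_add

lemma pow_mem_trigPoly {M : ℕ} {f : C(Torus, ℂ)} (hf : f ∈ trigPoly M) (n : ℕ) :
    f ^ n ∈ trigPoly (n * M) := by
  induction n with
  | zero => simpa using one_mem_trigPoly 0
  | succ n ih => rw [pow_succ, Nat.succ_mul]; exact mul_mem_trigPoly ih hf

lemma comp_addRight_mem_trigPoly {M : ℕ} {f : C(Torus, ℂ)} (hf : f ∈ trigPoly M) (t : Torus) :
    f.comp (ContinuousMap.addRight t) ∈ trigPoly M := by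
  induction hf using Submodule.span_induction with
  | mem f hf =>
    obtain ⟨m, hm, rfl⟩ := hf
    have : (fourier m).comp (ContinuousMap.addRight t) = (fourier m t : ℂ) • fourier m := by
      ext x; simp [smul_add, AddCircle.toCircle_add, mul_comm]
    rw [this]
    exact Submodule.smul_mem _ _ (fourier_mem_trigPoly (abs_le.2 hm))
  | zero => exact Submodule.zero_mem _
  | add f g _ _ hf hg => exact Submodule.add_mem _ hf hg
  | smul c f _ hf => exact Submodule.smul_mem _ c hf

lemma integral_fourier_mul_fourier (m n : ℤ) :
    ∫ x : Torus, fourier m x * fourier n x ∂AddCircle.haarAddCircle = if n = -m then 1 else 0 := by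
  have h := congrFun (fourierCoeff_fourier (T := 1) n) (-m)
  rw [_root_.fourierCoeff] at h
  simp only [neg_neg, smul_eq_mul] at h
  rw [h, Pi.single_apply]
  simp only [eq_comm]

lemma continuous_proj (M : ℕ) (ν : ComplexMeasure Torus) : Continuous (proj M ν) := by
  unfold proj; fun_prop

/-- Only the frequencies of `q` are seen by the pairing, so `ν` may be replaced by its
projection. -/
lemma cintegral_eq_integral_mul_proj {M : ℕ} {q : C(Torus, ℂ)} (hq : q ∈ trigPoly M)
    (ν : ComplexMeasure Torus) :
    cintegral ν q = ∫ x, q x * proj M ν x ∂AddCircle.haarAddCircle := by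
  have integrable_mul_proj (f : C(Torus, ℂ)) :
      Integrable (fun x => f x * proj M ν x) AddCircle.haarAddCircle :=
    integrable_of_continuous _ (f.continuous.mul (continuous_proj M ν))
  induction hq using Submodule.span_induction with
  | mem f hf =>
    obtain ⟨k, hk, rfl⟩ := hf
    have hk' : -k ∈ Finset.Icc (-(M : ℤ)) M := by
      simp only [Set.mem_Icc, Finset.mem_Icc] at hk ⊢; omega
    simp_rw [proj, Finset.mul_sum, mul_left_comm]
    rw [integral_finsetSum _ fun m _ => integrable_of_continuous _ (by fun_prop)]
    simp_rw [integral_const_mul, integral_fourier_mul_fourier, mul_ite, mul_one, mul_zero]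
    rw [Finset.sum_ite_eq' _ _ _, if_pos hk', fourierCoeff, neg_neg]
  | zero => simp [Pi.zero_def]
  | add f g _ _ hf hg =>
    have hfg := VectorMeasure.integral_add (μ := ν) (B := ContinuousLinearMap.mul ℝ ℂ)
      (integrable_of_continuous _ f.continuous) (integrable_of_continuous _ g.continuous)
    simp only [ContinuousMap.add_apply, add_mul]
    rw [integral_add (integrable_mul_proj f) (integrable_mul_proj g), ← hf, ← hg]
    exact hfg
  | smul c f _ hf =>
    simp only [ContinuousMap.smul_apply, smul_eq_mul, mul_assoc]
    rw [integral_const_mul, ← hf]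
    exact cintegral_const_mul ν c f

lemma integral_norm_le_l2Norm {f : Torus → ℂ} (hf : Continuous f) :
    ∫ x, ‖f x‖ ∂AddCircle.haarAddCircle ≤ l2Norm f := by
  have hmeas := hf.aestronglyMeasurable (μ := AddCircle.haarAddCircle (T := 1))
  rw [integral_norm_eq_lintegral_enorm hmeas, ← eLpNorm_one_eq_lintegral_enorm]
  refine ENNReal.toReal_mono ?_ (eLpNorm_le_eLpNorm_of_exponent_le (by norm_num) hmeas)
  exact ((ContinuousMap.mk f hf).memLp AddCircle.haarAddCircle ℂ).eLpNorm_ne_top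

lemma norm_cintegral_le_l2Norm_proj {M : ℕ} {q : C(Torus, ℂ)} (hq : q ∈ trigPoly M)
    (hq₁ : ∀ x, ‖q x‖ ≤ 1) (ν : ComplexMeasure Torus) :
    ‖cintegral ν q‖ ≤ l2Norm (proj M ν) := by
  have hp := continuous_proj M ν
  calc ‖cintegral ν q‖ ≤ ∫ x, ‖q x * proj M ν x‖ ∂AddCircle.haarAddCircle := by
        rw [cintegral_eq_integral_mul_proj hq]; exact norm_integral_le_integral_norm _
    _ ≤ ∫ x, ‖proj M ν x‖ ∂AddCircle.haarAddCircle := by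
        refine integral_mono (integrable_of_continuous _ (q.continuous.mul hp)).norm
          (integrable_of_continuous _ hp).norm fun x => ?_
        simpa only [norm_mul] using mul_le_of_le_one_left (norm_nonneg (proj M ν x)) (hq₁ x)
    _ ≤ l2Norm (proj M ν) := integral_norm_le_l2Norm hp

end TrigPoly

/-- A weight `g` is dual to `S` in degree `M` when all phases on `S` are interpolated by
trigonometric polynomials of degree `M` whose modulus stays below `1 - g`. -/
structure IsDualWeight (M : ℕ) (S : Finset Torus) (g : Torus → ℝ) : Prop where
  measurable : Measurable g
  nonneg : ∀ x, 0 ≤ g x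
  exists_interpolant : ∀ v : Torus → ℂ, (∀ s, ‖v s‖ = 1) →
    ∃ q ∈ trigPoly M, (∀ s ∈ S, q s = v s) ∧ ∀ x, ‖q x‖ ≤ 1 - g x

namespace IsDualWeight

variable {M : ℕ} {S : Finset Torus} {g : Torus → ℝ}

lemma integrable (hg : IsDualWeight M S g) (ν : Measure Torus) [IsFiniteMeasure ν] :
    Integrable g ν := by
  obtain ⟨q, -, -, hq⟩ := hg.exists_interpolant 1 (by simp)
  refine Integrable.of_bound hg.measurable.aestronglyMeasurable 1 (.of_forall fun x => ?_)
  rw [Real.norm_of_nonneg (hg.nonneg x)]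
  linarith [hq x, norm_nonneg (q x)]

lemma eq_zero_of_mem (hg : IsDualWeight M S g) {s : Torus} (hs : s ∈ S) : g s = 0 := by
  obtain ⟨q, -, hqS, hq⟩ := hg.exists_interpolant 1 (by simp)
  have h := hq s
  rw [hqS s hs, Pi.one_apply, norm_one] at h
  linarith [hg.nonneg s]

/-- The dual polynomial for the phases of `μ - μ₀` at the points of `S` is nearly orthogonal to
`μ - μ₀`, while the cone condition bounds the mass of `μ - μ₀` off `S`. -/
theorem integral_le (hg : IsDualWeight M S g) {ε : ℝ} {μ₀ μ : ComplexMeasure Torus}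
    (hS : (S : Set Torus) = support μ₀) (happ : IsApproximation ε M μ μ₀) :
    ∫ x, g x ∂(μ - μ₀).variation ≤ 4 * ε := by
  set ν := μ - μ₀
  choose v hv_norm hv using fun s => Complex.exists_norm_eq_mul_self (ν {s})
  obtain ⟨q, hqM, hqS, hq⟩ := hg.exists_interpolant v hv_norm
  have hq₁ (x : Torus) : ‖q x‖ ≤ 1 := (hq x).trans (sub_le_self 1 (hg.nonneg x))
  have pairing : ‖cintegral ν q‖ ≤ 2 * ε :=
    (norm_cintegral_le_l2Norm_proj hqM hq₁ ν).trans happ.2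
  have hqν : Integrable q ν.variation := integrable_of_continuous _ q.continuous
  have on_S := variation_real_finset_le hqν (S := S) fun s hs => by rw [hqS s hs, hv s]
  have cone : ν.variation.real (S : Set Torus)ᶜ ≤ ν.variation.real (S : Set Torus) + 2 * ε :=
    variation_real_sub_compl_le S.measurableSet (hS ▸ Measure.measure_compl_support) happ.1
  have off_S : ∫ x in (S : Set Torus)ᶜ, ‖q x‖ ∂ν.variation ≤
      ν.variation.real (S : Set Torus)ᶜ - ∫ x in (S : Set Torus)ᶜ, g x ∂ν.variation := by
    refine (integral_mono hqν.restrict.norm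
      ((integrable_const (1 : ℝ)).sub (hg.integrable _)) hq).trans_eq ?_
    rw [integral_sub' (integrable_const 1) (hg.integrable _), setIntegral_const, smul_eq_mul,
      mul_one]
  rw [← setIntegral_eq_integral_of_forall_compl_eq_zero (s := (S : Set Torus)ᶜ)
    fun x hx => hg.eq_zero_of_mem (by simpa using hx)]
  linarith

end IsDualWeight

section JacksonKernel

open Real

/-- The scaled cosecant `1 / (N sin (π u / N))`, through which the Jackson kernel and its
derivatives decay. It takes the junk value `0` at the multiples of `N`. -/
noncomputable def scaledCsc (N : ℕ) (u : ℝ) : ℝ := (N * sin (π * u / N))⁻¹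

/-- The Jackson kernel `(sin (π u) / (N sin (π u / N)))⁴` in the coordinate `u = N x`, whose
zeros are the nonzero integers. -/
noncomputable def jackson (N : ℕ) (u : ℝ) : ℝ := sin (π * u) ^ 4 * scaledCsc N u ^ 4

/-- The derivative of `jackson` away from the multiples of `N`. -/
noncomputable def jacksonDeriv (N : ℕ) (u : ℝ) : ℝ :=
  4 * π * (sin (π * u) ^ 3 * cos (π * u) * scaledCsc N u ^ 4 -
    cos (π * u / N) * sin (π * u) ^ 4 * scaledCsc N u ^ 5)

/-- The second derivative of `jackson` away from the multiples of `N`. -/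
noncomputable def jacksonDeriv₂ (N : ℕ) (u : ℝ) : ℝ :=
  4 * π ^ 2 * scaledCsc N u ^ 4 * (3 * sin (π * u) ^ 2 * cos (π * u) ^ 2 -
    sin (π * u) ^ 4 * (1 + 4 * (N : ℝ)⁻¹ ^ 2 - 5 * scaledCsc N u ^ 2) -
    8 * cos (π * u / N) * scaledCsc N u * (sin (π * u) ^ 3 * cos (π * u)))

/-- The odd companion `jackson N u * (N sin (2π u / N) / (2π))` of the Jackson kernel, which is
used to prescribe derivatives; one power of the cosecant has been cancelled. -/
noncomputable def jacksonOdd (N : ℕ) (u : ℝ) : ℝ :=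
  sin (π * u) ^ 4 * scaledCsc N u ^ 3 * cos (π * u / N) / π

/-- The derivative of `jacksonOdd` away from the multiples of `N`. -/
noncomputable def jacksonOddDeriv (N : ℕ) (u : ℝ) : ℝ :=
  4 * (sin (π * u) ^ 3 * cos (π * u)) * scaledCsc N u ^ 3 * cos (π * u / N) +
    sin (π * u) ^ 4 * (2 * scaledCsc N u ^ 2 * (N : ℝ)⁻¹ ^ 2 - 3 * scaledCsc N u ^ 4)

/-- The second derivative of `jacksonOdd` away from the multiples of `N`. -/
noncomputable def jacksonOddDeriv₂ (N : ℕ) (u : ℝ) : ℝ :=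
  4 * π * (scaledCsc N u ^ 3 * cos (π * u / N) * (3 * sin (π * u) ^ 2 * cos (π * u) ^ 2 -
    sin (π * u) ^ 4 * (1 + (N : ℝ)⁻¹ ^ 2 - 3 * scaledCsc N u ^ 2)) +
    2 * (sin (π * u) ^ 3 * cos (π * u)) *
      (2 * scaledCsc N u ^ 2 * (N : ℝ)⁻¹ ^ 2 - 3 * scaledCsc N u ^ 4))

variable {N : ℕ} {u : ℝ}

lemma natCast_ne_zero_of_sin_ne_zero (h : sin (π * u / N) ≠ 0) : (N : ℝ) ≠ 0 := by
  intro hN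
  simp [hN] at h

lemma scaledCsc_mul_sin (h : sin (π * u / N) ≠ 0) :
    scaledCsc N u * sin (π * u / N) = (N : ℝ)⁻¹ := by
  rw [scaledCsc, mul_inv, mul_assoc, inv_mul_cancel₀ h, mul_one]

lemma scaledCsc_sq_mul_one_sub_cos_sq (h : sin (π * u / N) ≠ 0) :
    scaledCsc N u ^ 2 * (1 - cos (π * u / N) ^ 2) = (N : ℝ)⁻¹ ^ 2 := by
  rw [← sin_sq, ← mul_pow, scaledCsc_mul_sin h]

lemma jacksonOdd_eq_mul (h : sin (π * u / N) ≠ 0) :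
    jacksonOdd N u = jackson N u * (N * (sin (π * u / N) * cos (π * u / N)) / π) := by
  have hN := mul_inv_cancel₀ (natCast_ne_zero_of_sin_ne_zero h)
  rw [← scaledCsc_mul_sin h] at hN
  rw [jacksonOdd, jackson]
  linear_combination (-sin (π * u) ^ 4 * scaledCsc N u ^ 3 * cos (π * u / N) / π) * hN

lemma hasDerivAt_sin_pi (u : ℝ) : HasDerivAt (fun u => sin (π * u)) (π * cos (π * u)) u := by
  simpa [mul_comm] using ((hasDerivAt_id u).const_mul π).sin

lemma hasDerivAt_cos_pi (u : ℝ) : HasDerivAt (fun u => cos (π * u)) (-(π * sin (π * u))) u := by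
  simpa [mul_comm] using ((hasDerivAt_id u).const_mul π).cos

lemma hasDerivAt_cos_pi_div (h : sin (π * u / N) ≠ 0) :
    HasDerivAt (fun u => cos (π * u / N))
      (-(π * scaledCsc N u * (1 - cos (π * u / N) ^ 2))) u := by
  refine (((hasDerivAt_id u).const_mul π).div_const (N : ℝ)).cos.congr_deriv ?_
  rw [← sin_sq, id, mul_one, div_eq_mul_inv π (N : ℝ), ← scaledCsc_mul_sin h]
  ring

lemma hasDerivAt_scaledCsc (h : sin (π * u / N) ≠ 0) :
    HasDerivAt (scaledCsc N) (-(π * cos (π * u / N) * scaledCsc N u ^ 2)) u := by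
  have hN := natCast_ne_zero_of_sin_ne_zero h
  refine (((((hasDerivAt_id u).const_mul π).div_const (N : ℝ)).sin.const_mul (N : ℝ)).inv
    (mul_ne_zero hN h)).congr_deriv ?_
  simp only [scaledCsc, id]
  field_simp

lemma hasDerivAt_jackson (h : sin (π * u / N) ≠ 0) :
    HasDerivAt (jackson N) (jacksonDeriv N u) u := by
  refine (((hasDerivAt_sin_pi u).fun_pow 4).fun_mul
    ((hasDerivAt_scaledCsc h).fun_pow 4)).congr_deriv ?_
  rw [jacksonDeriv]
  push_cast
  ring

lemma hasDerivAt_jacksonDeriv (h : sin (π * u / N) ≠ 0) :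
    HasDerivAt (jacksonDeriv N) (jacksonDeriv₂ N u) u := by
  have hw := hasDerivAt_scaledCsc h
  refine ((((((hasDerivAt_sin_pi u).fun_pow 3).fun_mul (hasDerivAt_cos_pi u)).fun_mul
    (hw.fun_pow 4)).fun_sub (((hasDerivAt_cos_pi_div h).fun_mul
      ((hasDerivAt_sin_pi u).fun_pow 4)).fun_mul (hw.fun_pow 5))).const_mul
        (4 * π)).congr_deriv ?_
  rw [jacksonDeriv₂]
  push_cast
  linear_combination (-16 * π ^ 2 * sin (π * u) ^ 4 * scaledCsc N u ^ 4) *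
    scaledCsc_sq_mul_one_sub_cos_sq h

lemma hasDerivAt_jacksonOdd (h : sin (π * u / N) ≠ 0) :
    HasDerivAt (jacksonOdd N) (jacksonOddDeriv N u) u := by
  refine (((((hasDerivAt_sin_pi u).fun_pow 4).fun_mul ((hasDerivAt_scaledCsc h).fun_pow 3)).fun_mul
    (hasDerivAt_cos_pi_div h)).div_const π).congr_deriv ?_
  rw [div_eq_iff pi_ne_zero, jacksonOddDeriv]
  push_cast
  linear_combination (2 * π * sin (π * u) ^ 4 * scaledCsc N u ^ 2) *
    scaledCsc_sq_mul_one_sub_cos_sq h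

lemma hasDerivAt_jacksonOddDeriv (h : sin (π * u / N) ≠ 0) :
    HasDerivAt (jacksonOddDeriv N) (jacksonOddDeriv₂ N u) u := by
  have hw := hasDerivAt_scaledCsc h
  refine (((((((hasDerivAt_sin_pi u).fun_pow 3).fun_mul (hasDerivAt_cos_pi u)).const_mul 4).fun_mul
    (hw.fun_pow 3)).fun_mul (hasDerivAt_cos_pi_div h)).fun_add
      (((hasDerivAt_sin_pi u).fun_pow 4).fun_mul
        ((((hw.fun_pow 2).const_mul 2).mul_const ((N : ℝ)⁻¹ ^ 2)).fun_sub
          ((hw.fun_pow 4).const_mul 3)))).congr_deriv ?_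
  rw [jacksonOddDeriv₂]
  push_cast
  linear_combination (8 * π * sin (π * u) ^ 3 * cos (π * u) * scaledCsc N u ^ 2) *
    scaledCsc_sq_mul_one_sub_cos_sq h

lemma sq_inv_le_scaledCsc_sq (h : sin (π * u / N) ≠ 0) :
    (N : ℝ)⁻¹ ^ 2 ≤ scaledCsc N u ^ 2 := by
  rw [← scaledCsc_mul_sin h, mul_pow]
  exact mul_le_of_le_one_right (sq_nonneg _) (sin_sq_le_one _)

lemma abs_two_mul_scaledCsc_sq_sub_le (h : sin (π * u / N) ≠ 0) :
    |2 * scaledCsc N u ^ 2 * (N : ℝ)⁻¹ ^ 2 - 3 * scaledCsc N u ^ 4| ≤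
      3 * |scaledCsc N u| ^ 4 := by
  have upper := mul_le_mul_of_nonneg_left (sq_inv_le_scaledCsc_sq h) (sq_nonneg (scaledCsc N u))
  have lower : 0 ≤ scaledCsc N u ^ 2 * (N : ℝ)⁻¹ ^ 2 := by positivity
  rw [Even.pow_abs (by decide), abs_le]
  constructor <;> nlinarith

lemma abs_sin_cube_mul_cos_le (x : ℝ) : |sin x ^ 3 * cos x| ≤ 0.325 := by
  -- The maximum is `3 √3 / 16 ≈ 0.3248`, attained where `sin² x = 3 / 4`.
  refine abs_le_of_sq_le_sq ?_ (by norm_num)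
  have h := cos_sq' x
  have : (sin x ^ 3 * cos x) ^ 2 = (sin x ^ 2) ^ 3 * (1 - sin x ^ 2) := by rw [← h]; ring
  rw [this]
  generalize sin x ^ 2 = y
  nlinarith [mul_nonneg (sq_nonneg (y - 3 / 4))
    (add_nonneg (sq_nonneg (y + 1 / 4)) (by norm_num : (0 : ℝ) ≤ 1 / 8))]

lemma abs_three_mul_sin_sq_mul_cos_sq_sub_le (x : ℝ) {E : ℝ} (h0 : 0 ≤ E) (h1 : E ≤ 1) :
    |3 * sin x ^ 2 * cos x ^ 2 - sin x ^ 4 * E| ≤ 1 := by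
  rw [cos_sq']
  have hy0 := sq_nonneg (sin x)
  have hy1 := sin_sq_le_one x
  have : sin x ^ 4 = (sin x ^ 2) ^ 2 := by ring
  rw [this]
  generalize sin x ^ 2 = y at *
  have h2 : y ^ 2 * E ≤ 1 := by
    calc y ^ 2 * E ≤ 1 * 1 := by gcongr; nlinarith
      _ = 1 := one_mul 1
  have h3 : 0 ≤ y ^ 2 * E := by positivity
  rw [abs_le]
  constructor <;> nlinarith [sq_nonneg (y - 1 / 2)]

lemma abs_sin_pow_le_one (x : ℝ) (n : ℕ) : |sin x| ^ n ≤ 1 :=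
  pow_le_one₀ (abs_nonneg _) (abs_sin_le_one _)

lemma abs_jackson_le (N : ℕ) (u : ℝ) : |jackson N u| ≤ |scaledCsc N u| ^ 4 := by
  rw [jackson, abs_mul, abs_pow, abs_pow]
  exact mul_le_of_le_one_left (by positivity) (abs_sin_pow_le_one _ _)

lemma abs_jacksonOdd_le (N : ℕ) (u : ℝ) : |jacksonOdd N u| ≤ |scaledCsc N u| ^ 3 / π := by
  rw [jacksonOdd, abs_div, abs_of_pos pi_pos, abs_mul, abs_mul, abs_pow, abs_pow]
  gcongr
  have hsin := abs_sin_pow_le_one (π * u) 4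
  have hcos := abs_cos_le_one (π * u / N)
  calc _ ≤ 1 * |scaledCsc N u| ^ 3 * 1 := by gcongr
    _ = |scaledCsc N u| ^ 3 := by ring

lemma abs_jacksonDeriv_le (N : ℕ) (u : ℝ) :
    |jacksonDeriv N u| ≤ 4 * π * |scaledCsc N u| ^ 4 * (0.325 + |scaledCsc N u|) := by
  have hsin_cos := abs_sin_cube_mul_cos_le (π * u)
  have hsin := abs_sin_pow_le_one (π * u) 4
  have hcos := abs_cos_le_one (π * u / N)
  rw [jacksonDeriv, abs_mul, abs_of_pos (by positivity : 0 < 4 * π)]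
  calc _ ≤ 4 * π * (|sin (π * u) ^ 3 * cos (π * u)| * |scaledCsc N u| ^ 4 +
        |cos (π * u / N)| * |sin (π * u)| ^ 4 * |scaledCsc N u| ^ 5) := by
        gcongr
        refine (abs_sub _ _).trans_eq ?_
        simp only [abs_mul, abs_pow]
    _ ≤ 4 * π * (0.325 * |scaledCsc N u| ^ 4 + 1 * 1 * |scaledCsc N u| ^ 5) := by gcongr
    _ = _ := by ring

lemma abs_jacksonOddDeriv_le (h : sin (π * u / N) ≠ 0) :
    |jacksonOddDeriv N u| ≤ 1.3 * |scaledCsc N u| ^ 3 + 3 * |scaledCsc N u| ^ 4 := by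
  have hsin_cos := abs_sin_cube_mul_cos_le (π * u)
  have hsin := abs_sin_pow_le_one (π * u) 4
  have hcos := abs_cos_le_one (π * u / N)
  have hdiff := abs_two_mul_scaledCsc_sq_sub_le h
  rw [jacksonOddDeriv]
  calc _ ≤ 4 * |sin (π * u) ^ 3 * cos (π * u)| * |scaledCsc N u| ^ 3 * |cos (π * u / N)| +
        |sin (π * u)| ^ 4 *
          |2 * scaledCsc N u ^ 2 * (N : ℝ)⁻¹ ^ 2 - 3 * scaledCsc N u ^ 4| := by
        refine (abs_add_le _ _).trans_eq ?_
        simp only [abs_mul, abs_pow, Nat.abs_ofNat]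
    _ ≤ 4 * 0.325 * |scaledCsc N u| ^ 3 * 1 + 1 * (3 * |scaledCsc N u| ^ 4) := by gcongr
    _ = _ := by ring

lemma abs_jacksonDeriv₂_le (h : sin (π * u / N) ≠ 0) (hw : |scaledCsc N u| ≤ 0.43) :
    |jacksonDeriv₂ N u| ≤ 4 * π ^ 2 * |scaledCsc N u| ^ 4 * (1 + 2.6 * |scaledCsc N u|) := by
  have hsin_cos := abs_sin_cube_mul_cos_le (π * u)
  have hcos := abs_cos_le_one (π * u / N)
  have hinv := sq_inv_le_scaledCsc_sq h
  have hsq : scaledCsc N u ^ 2 ≤ 0.43 ^ 2 := by rw [← sq_abs]; gcongr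
  have hquad := abs_three_mul_sin_sq_mul_cos_sq_sub_le (π * u)
    (E := 1 + 4 * (N : ℝ)⁻¹ ^ 2 - 5 * scaledCsc N u ^ 2) (by nlinarith) (by nlinarith)
  rw [jacksonDeriv₂, abs_mul, abs_mul, abs_of_pos (by positivity : 0 < 4 * π ^ 2), abs_pow]
  gcongr
  refine (abs_sub _ _).trans ?_
  calc _ ≤ 1 + 8 * |cos (π * u / N)| * |scaledCsc N u| * |sin (π * u) ^ 3 * cos (π * u)| := by
        refine add_le_add hquad (le_of_eq ?_)
        simp only [abs_mul, abs_pow, Nat.abs_ofNat]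
    _ ≤ 1 + 8 * 1 * |scaledCsc N u| * 0.325 := by gcongr
    _ = _ := by ring

lemma abs_jacksonOddDeriv₂_le (h : sin (π * u / N) ≠ 0) (hw : |scaledCsc N u| ≤ 0.43) :
    |jacksonOddDeriv₂ N u| ≤ 4 * π * |scaledCsc N u| ^ 3 * (1 + 1.95 * |scaledCsc N u|) := by
  have hsin_cos := abs_sin_cube_mul_cos_le (π * u)
  have hcos := abs_cos_le_one (π * u / N)
  have hinv := sq_inv_le_scaledCsc_sq h
  have hsq : scaledCsc N u ^ 2 ≤ 0.43 ^ 2 := by rw [← sq_abs]; gcongr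
  have hquad := abs_three_mul_sin_sq_mul_cos_sq_sub_le (π * u)
    (E := 1 + (N : ℝ)⁻¹ ^ 2 - 3 * scaledCsc N u ^ 2) (by nlinarith) (by nlinarith)
  have hdiff := abs_two_mul_scaledCsc_sq_sub_le h
  rw [jacksonOddDeriv₂, abs_mul, abs_of_pos (by positivity : 0 < 4 * π), mul_assoc (4 * π)]
  refine mul_le_mul_of_nonneg_left ?_ (by positivity)
  refine (abs_add_le _ _).trans ?_
  rw [abs_mul, abs_mul, abs_pow, abs_mul (2 * _), abs_mul 2, abs_two]
  calc _ ≤ |scaledCsc N u| ^ 3 * 1 * 1 + 2 * 0.325 * (3 * |scaledCsc N u| ^ 4) := by gcongr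
    _ = _ := by ring

end JacksonKernel

section CircleKernel

open Real

/-- The squared, normalized Dirichlet sum `|N⁻¹ ∑_{k < N} e^{2πikx}|²`, a Fejér kernel. -/
noncomputable def fejerCircle (N : ℕ) : C(Torus, ℂ) :=
  ((N : ℂ)⁻¹ ^ 2) • ((∑ k ∈ Finset.range N, fourier (k : ℤ)) *
    ∑ k ∈ Finset.range N, fourier (-(k : ℤ)))

/-- The Jackson kernel on the circle, the square of the Fejér kernel; see `jacksonCircle_coe` for
its relation with `jackson`. -/
noncomputable def jacksonCircle (N : ℕ) : C(Torus, ℂ) := fejerCircle N ^ 2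

/-- The odd companion of the Jackson kernel on the circle; see `jacksonOddCircle_coe` for its
relation with `jacksonOdd`. -/
noncomputable def jacksonOddCircle (N : ℕ) : C(Torus, ℂ) :=
  jacksonCircle N * ((N : ℂ) / (4 * π * Complex.I)) • (fourier 1 - fourier (-1))

variable {N : ℕ} {u : ℝ}

lemma fejerCircle_mem_trigPoly (N : ℕ) : fejerCircle N ∈ trigPoly (N - 1) := by
  refine Submodule.smul_mem _ _ ?_
  rw [Finset.sum_mul_sum]
  refine Submodule.sum_mem _ fun k hk => Submodule.sum_mem _ fun l hl => ?_
  have hmul : (fourier (k : ℤ) * fourier (-(l : ℤ)) : C(Torus, ℂ)) = fourier ((k : ℤ) - l) := by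
    ext x; rw [sub_eq_add_neg, fourier_add]; rfl
  rw [Finset.mem_range] at hk hl
  rw [hmul]
  exact fourier_mem_trigPoly (by rw [abs_le]; omega)

lemma jacksonCircle_mem_trigPoly (N : ℕ) : jacksonCircle N ∈ trigPoly (2 * (N - 1)) :=
  pow_mem_trigPoly (fejerCircle_mem_trigPoly N) 2

lemma jacksonOddCircle_mem_trigPoly (N : ℕ) :
    jacksonOddCircle N ∈ trigPoly (2 * (N - 1) + 1) :=
  mul_mem_trigPoly (jacksonCircle_mem_trigPoly N) <| Submodule.smul_mem _ _ <|
    Submodule.sub_mem _ (fourier_mem_trigPoly (by simp)) (fourier_mem_trigPoly (by simp))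

lemma jacksonCircle_zero (hN : 0 < N) : jacksonCircle N 0 = 1 := by
  have hN' : (N : ℂ) ≠ 0 := by exact_mod_cast hN.ne'
  simp only [jacksonCircle, fejerCircle, ContinuousMap.pow_apply, ContinuousMap.smul_apply,
    ContinuousMap.mul_apply, ContinuousMap.sum_apply, fourier_eval_zero, Finset.sum_const,
    Finset.card_range, smul_eq_mul, nsmul_eq_mul, mul_one]
  field_simp

lemma jacksonOddCircle_zero (N : ℕ) : jacksonOddCircle N 0 = 0 := by
  simp [jacksonOddCircle]

lemma exp_sub_one_mul_exp_inv_sub_one (θ : ℝ) :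
    (Complex.exp (2 * θ * Complex.I) - 1) * ((Complex.exp (2 * θ * Complex.I))⁻¹ - 1) =
      4 * (sin θ : ℂ) ^ 2 := by
  have h := Complex.exp_ne_zero (θ * Complex.I)
  rw [Complex.ofReal_sin, Complex.sin, mul_assoc, two_mul, Complex.exp_add, neg_mul,
    Complex.exp_neg]
  field_simp
  rw [Complex.I_sq]
  ring

lemma geom_sum_exp_mul_geom_sum_exp_inv (N : ℕ) (θ : ℝ) :
    (∑ k ∈ Finset.range N, Complex.exp (2 * θ * Complex.I) ^ k) *
      (∑ k ∈ Finset.range N, (Complex.exp (2 * θ * Complex.I))⁻¹ ^ k) * (sin θ : ℂ) ^ 2 =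
        (sin (N * θ) : ℂ) ^ 2 := by
  have hθ := exp_sub_one_mul_exp_inv_sub_one θ
  have hNθ := exp_sub_one_mul_exp_inv_sub_one (N * θ)
  have hpow : Complex.exp (2 * (N * θ : ℝ) * Complex.I) = Complex.exp (2 * θ * Complex.I) ^ N := by
    rw [← Complex.exp_nat_mul]; push_cast; ring_nf
  rw [hpow] at hNθ
  generalize Complex.exp (2 * θ * Complex.I) = z at *
  have hz := geom_sum_mul z N
  have hz' := geom_sum_mul z⁻¹ N
  rw [inv_pow] at hz'
  refine mul_left_cancel₀ (by norm_num : (4 : ℂ) ≠ 0) ?_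
  rw [← hNθ, ← hz, ← hz']
  linear_combination
    (-(∑ k ∈ Finset.range N, z ^ k) * (∑ k ∈ Finset.range N, z⁻¹ ^ k)) * hθ

lemma fourier_coe_div (N : ℕ) (m : ℤ) (u : ℝ) : (fourier m ((u / N : ℝ) : Torus) : ℂ) =
    Complex.exp (2 * (π * u / N : ℝ) * Complex.I) ^ m := by
  rw [fourier_coe_apply, ← Complex.exp_int_mul]
  push_cast
  ring_nf

lemma fejerCircle_coe (h : sin (π * u / N) ≠ 0) :
    fejerCircle N ((u / N : ℝ) : Torus) = (sin (π * u) * scaledCsc N u : ℝ) ^ 2 := by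
  have hN : (N : ℝ) ≠ 0 := natCast_ne_zero_of_sin_ne_zero h
  have hsum := geom_sum_exp_mul_geom_sum_exp_inv N (π * u / N)
  rw [mul_div_cancel₀ _ hN, ← eq_div_iff (pow_ne_zero 2 (by exact_mod_cast h))] at hsum
  simp only [fejerCircle, ContinuousMap.smul_apply, ContinuousMap.mul_apply,
    ContinuousMap.sum_apply, smul_eq_mul, fourier_coe_div, zpow_neg, zpow_natCast, ← inv_pow, hsum]
  rw [scaledCsc]
  push_cast
  ring

lemma jacksonCircle_coe (h : sin (π * u / N) ≠ 0) :
    jacksonCircle N ((u / N : ℝ) : Torus) = jackson N u := by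
  rw [jacksonCircle, ContinuousMap.pow_apply, fejerCircle_coe h, jackson]
  push_cast
  ring

lemma jacksonOddCircle_coe (h : sin (π * u / N) ≠ 0) :
    jacksonOddCircle N ((u / N : ℝ) : Torus) = jacksonOdd N u := by
  have hπ : (π : ℂ) ≠ 0 := by exact_mod_cast pi_ne_zero
  have hsin := Complex.sin_two_mul ((π * u / N : ℝ) : ℂ)
  have hsub : fourier 1 ((u / N : ℝ) : Torus) - fourier (-1) ((u / N : ℝ) : Torus) =
      2 * Complex.I * Complex.sin (2 * (π * u / N : ℝ)) := by
    rw [fourier_coe_div, fourier_coe_div, zpow_one, zpow_neg, zpow_one, ← Complex.exp_neg,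
      Complex.sin, neg_mul]
    linear_combination (Complex.exp (-(2 * (π * u / N : ℝ) * Complex.I)) -
      Complex.exp (2 * (π * u / N : ℝ) * Complex.I)) * -Complex.I_sq
  rw [jacksonOdd_eq_mul h, jacksonOddCircle, ContinuousMap.mul_apply, jacksonCircle_coe h,
    ContinuousMap.smul_apply, ContinuousMap.sub_apply, hsub, hsin, smul_eq_mul]
  push_cast
  field_simp
  norm_num

end CircleKernel

section Separation

lemma exists_coe_eq_abs_eq_norm (x : Torus) : ∃ t : ℝ, (t : Torus) = x ∧ |t| = ‖x‖ := by
  obtain ⟨y, rfl⟩ := QuotientAddGroup.mk_surjective x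
  refine ⟨y - round y, ?_, UnitAddCircle.norm_eq.symm⟩
  have hround : ((round y : ℝ) : Torus) = 0 :=
    (AddCircle.coe_eq_zero_iff (p := (1 : ℝ))).2 ⟨round y, by simp⟩
  rw [AddCircle.coe_sub, hround, sub_zero]

lemma norm_le_half (x : Torus) : ‖x‖ ≤ 1 / 2 := by
  simpa using AddCircle.norm_le_half_period (p := (1 : ℝ)) one_ne_zero (x := x)

lemma mul_norm_sub_le_mul_norm {N : ℕ} {x y : Torus} {c : ℝ} (h : N * ‖y - x‖ ≤ c) :
    N * ‖x‖ - c ≤ N * ‖y‖ := by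
  have htri : ‖x‖ ≤ ‖y‖ + ‖y - x‖ := by simpa using norm_sub_le y (y - x)
  nlinarith [mul_le_mul_of_nonneg_left htri (Nat.cast_nonneg (α := ℝ) N)]

/-- Distinct points of `S` are at distance at least `1 / N`, that is, at least `1` apart in the
coordinate `u = N x` of `jackson`. -/
def IsUnitSeparated (N : ℕ) (S : Finset Torus) : Prop :=
  (S : Set Torus).Pairwise fun s t => 1 ≤ N * ‖s - t‖

lemma IsUnitSeparated.mono {N : ℕ} {S T : Finset Torus} (hS : IsUnitSeparated N S) (h : T ⊆ S) :
    IsUnitSeparated N T :=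
  Set.Pairwise.mono (Finset.coe_subset.2 h) hS

lemma IsUnitSeparated.one_le_of_mem_erase {N : ℕ} {S : Finset Torus} (hS : IsUnitSeparated N S)
    {s t : Torus} (hs : s ∈ S) (ht : t ∈ S.erase s) : 1 ≤ N * ‖s - t‖ :=
  hS hs (Finset.mem_of_mem_erase ht) (Finset.ne_of_mem_erase ht).symm

lemma abs_sub_lt_one_of_natFloor_eq {a b : ℝ} (ha : 0 ≤ a) (hb : 0 ≤ b) (h : ⌊a⌋₊ = ⌊b⌋₊) :
    |a - b| < 1 := by
  have hab : (⌊a⌋₊ : ℝ) = ⌊b⌋₊ := by rw [h]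
  rw [abs_sub_lt_iff]
  constructor <;> linarith [Nat.floor_le ha, Nat.floor_le hb, Nat.lt_floor_add_one a,
    Nat.lt_floor_add_one b]

lemma sum_natFloor_le_sum_range {ι : Type*} {T : Finset ι} {a : ι → ℝ} (ha : ∀ i ∈ T, 0 ≤ a i)
    (hsep : (T : Set ι).Pairwise fun i j => 1 ≤ |a i - a j|) {n : ℕ} (hn : ∀ i ∈ T, ⌊a i⌋₊ < n)
    {φ : ℕ → ℝ} (hφ : ∀ k, 0 ≤ φ k) :
    ∑ i ∈ T, φ ⌊a i⌋₊ ≤ ∑ k ∈ Finset.range n, φ k := by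
  have hinj : Set.InjOn (fun i => ⌊a i⌋₊) (T : Set ι) := fun i hi j hj hij => by
    by_contra hne
    exact (hsep hi hj hne).not_gt (abs_sub_lt_one_of_natFloor_eq (ha i hi) (ha j hj) hij)
  rw [← Finset.sum_image (f := φ) hinj]
  refine Finset.sum_le_sum_of_subset_of_nonneg (fun k hk => ?_) fun _ _ _ => hφ _
  obtain ⟨i, hi, rfl⟩ := Finset.mem_image.1 hk
  exact Finset.mem_range.2 (hn i hi)

lemma natFloor_mul_norm_lt (N : ℕ) (x : Torus) : ⌊N * ‖x‖⌋₊ < N / 2 + 1 := by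
  rw [Nat.lt_succ_iff]
  refine (Nat.floor_mono (?_ : _ ≤ (N : ℝ) / (2 : ℕ))).trans_eq (Nat.floor_div_eq_div N 2)
  push_cast
  nlinarith [Nat.cast_nonneg (α := ℝ) N, norm_le_half x]

-- A bin of width `1 / N` of distances to `y` contains at most one point on each side of `y`.
lemma IsUnitSeparated.sum_natFloor_le {N : ℕ} {S : Finset Torus} (hS : IsUnitSeparated N S)
    (y : Torus) {φ : ℕ → ℝ} (hφ : ∀ k, 0 ≤ φ k) :
    ∑ s ∈ S, φ ⌊N * ‖y - s‖⌋₊ ≤ 2 * ∑ k ∈ Finset.range (N / 2 + 1), φ k := by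
  choose l hl_coe hl_abs using fun s : Torus => exists_coe_eq_abs_eq_norm (y - s)
  have hl_sub : ∀ s t, ‖s - t‖ ≤ |l s - l t| := fun s t => by
    have hst : s - t = ((l t - l s : ℝ) : Torus) := by
      rw [AddCircle.coe_sub, hl_coe, hl_coe]; abel
    rw [hst, abs_sub_comm]
    exact QuotientAddGroup.norm_mk_le_norm
  have hside : ∀ T ⊆ S, (∀ s ∈ T, ∀ t ∈ T, |‖y - s‖ - ‖y - t‖| = |l s - l t|) →
      ∑ s ∈ T, φ ⌊N * ‖y - s‖⌋₊ ≤ ∑ k ∈ Finset.range (N / 2 + 1), φ k := by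
    refine fun T hT hl => sum_natFloor_le_sum_range (fun _ _ => by positivity)
      (fun s hs t ht hst => ?_) (fun s _ => natFloor_mul_norm_lt N _) hφ
    change 1 ≤ |N * ‖y - s‖ - N * ‖y - t‖|
    rw [← mul_sub, abs_mul, Nat.abs_cast, hl s hs t ht]
    exact (hS.mono hT hs ht hst).trans (by gcongr; exact hl_sub s t)
  rw [← Finset.sum_filter_add_sum_filter_not S (fun s => 0 ≤ l s), two_mul]
  refine add_le_add (hside _ (Finset.filter_subset _ _) fun s hs t ht => ?_)
    (hside _ (Finset.filter_subset _ _) fun s hs t ht => ?_)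
  · rw [← hl_abs, ← hl_abs, abs_of_nonneg (Finset.mem_filter.1 hs).2,
      abs_of_nonneg (Finset.mem_filter.1 ht).2]
  · rw [← hl_abs, ← hl_abs, abs_of_neg (not_le.1 (Finset.mem_filter.1 hs).2),
      abs_of_neg (not_le.1 (Finset.mem_filter.1 ht).2), neg_sub_neg, abs_sub_comm]

end Separation

section Decay

open Real

/-- The modulus of `scaledCsc N` as a function on the circle; see `abs_scaledCsc`. -/
noncomputable def circleCsc (N : ℕ) (x : Torus) : ℝ := (N * sin (π * ‖x‖))⁻¹

variable {N : ℕ} {x : Torus}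

lemma abs_sin_pi_mul (t : ℝ) : |sin (π * t)| = sin (π * ‖(t : Torus)‖) := by
  have hround : |sin (π * t)| = |sin (π * (t - round t))| := by
    rw [show π * (t - round t) = π * t - round t * π by ring, sin_sub_int_mul_pi, abs_mul,
      abs_zpow, abs_neg, abs_one, one_zpow, one_mul]
  have hle : |π * (t - round t)| ≤ π := by
    rw [abs_mul, abs_of_pos pi_pos]
    exact mul_le_of_le_one_right pi_pos.le ((abs_sub_round t).trans (by norm_num))
  rw [hround, abs_sin_eq_sin_abs_of_abs_le_pi hle, abs_mul, abs_of_pos pi_pos,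
    UnitAddCircle.norm_eq]

lemma sin_pi_mul_norm_pos (hx : x ≠ 0) : 0 < sin (π * ‖x‖) :=
  sin_pos_of_pos_of_lt_pi (mul_pos pi_pos (norm_pos_iff.2 hx))
    (by nlinarith [pi_pos, norm_le_half x])

lemma sin_pi_mul_div_ne_zero {u : ℝ} (h : ((u / N : ℝ) : Torus) ≠ 0) : sin (π * u / N) ≠ 0 := by
  rw [mul_div_assoc, ← abs_pos, abs_sin_pi_mul]
  exact sin_pi_mul_norm_pos h

lemma abs_scaledCsc (N : ℕ) (u : ℝ) : |scaledCsc N u| = circleCsc N ((u / N : ℝ) : Torus) := by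
  rw [scaledCsc, circleCsc, abs_inv, abs_mul, Nat.abs_cast, mul_div_assoc, abs_sin_pi_mul]

lemma circleCsc_nonneg (N : ℕ) (x : Torus) : 0 ≤ circleCsc N x := by
  have hsin : 0 ≤ sin (π * ‖x‖) :=
    sin_nonneg_of_nonneg_of_le_pi (by positivity) (by nlinarith [pi_pos, norm_le_half x])
  rw [circleCsc]
  positivity

lemma circleCsc_le_inv_two_mul {r : ℝ} (hr : 0 < r) (h : r ≤ N * ‖x‖) :
    circleCsc N x ≤ (2 * r)⁻¹ := by
  rw [circleCsc]
  refine inv_anti₀ (by positivity) ?_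
  have hjordan := mul_le_sin (x := π * ‖x‖) (by positivity)
    (by nlinarith [pi_pos, norm_le_half x])
  calc 2 * r ≤ 2 * (N * ‖x‖) := by gcongr
    _ = N * (2 / π * (π * ‖x‖)) := by field_simp
    _ ≤ N * sin (π * ‖x‖) := by gcongr

lemma circleCsc_le_inv_mul {r δ : ℝ} (hr : 0 < r) (h : r ≤ N * ‖x‖) (hδ : 0 < δ)
    (hrδ : (π * r / N) ^ 2 ≤ 6 * (1 - δ)) : circleCsc N x ≤ (δ * (π * r))⁻¹ := by
  have hN : (0 : ℝ) < N := by
    by_contra! hN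
    nlinarith [norm_nonneg x]
  have hθ : 0 < π * r / N := by positivity
  have hrx : π * r / N ≤ π * ‖x‖ := by
    rw [mul_div_assoc]
    gcongr
    rwa [div_le_iff₀' hN]
  rw [circleCsc]
  refine inv_anti₀ (by positivity) ?_
  calc δ * (π * r) = N * (δ * (π * r / N)) := by field_simp
    _ ≤ N * (π * r / N - (π * r / N) ^ 3 / 6) := by gcongr; nlinarith
    _ ≤ N * sin (π * r / N) := by gcongr; exact sin_ge_sub_cube hθ.le
    _ ≤ N * sin (π * ‖x‖) := by
      gcongr
      exact sin_le_sin_of_le_of_le_pi_div_two (by linarith [pi_pos])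
        (by nlinarith [pi_pos, norm_le_half x]) hrx

lemma circleCsc_le_of_le_one (hN : 64 ≤ N) {r : ℝ} (hr : 0 < r) (hr1 : r ≤ 1)
    (h : r ≤ N * ‖x‖) : circleCsc N x ≤ (3.1402 * r)⁻¹ := by
  have hN' : (64 : ℝ) ≤ N := by exact_mod_cast hN
  have hθ : π * r / N ≤ 0.0491 := by
    rw [div_le_iff₀ (by linarith)]
    nlinarith [pi_lt_d4, pi_pos]
  refine (circleCsc_le_inv_mul hr h (δ := 0.99959) (by norm_num) ?_).trans ?_
  · calc (π * r / N) ^ 2 ≤ 0.0491 ^ 2 := by gcongr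
      _ ≤ _ := by norm_num
  · rw [← mul_assoc]
    gcongr
    nlinarith [pi_gt_d4]

lemma circleCsc_le_of_le_six (hN : 64 ≤ N) {r : ℝ} (hr : 0 < r) (hr6 : r ≤ 6)
    (h : r ≤ N * ‖x‖) : circleCsc N x ≤ (3.0958 * r)⁻¹ := by
  have hN' : (64 : ℝ) ≤ N := by exact_mod_cast hN
  have hθ : π * r / N ≤ 0.2946 := by
    rw [div_le_iff₀ (by linarith)]
    nlinarith [pi_lt_d4, pi_pos]
  refine (circleCsc_le_inv_mul hr h (δ := 0.98547) (by norm_num) ?_).trans ?_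
  · calc (π * r / N) ^ 2 ≤ 0.2946 ^ 2 := by gcongr
      _ ≤ _ := by norm_num
  · rw [← mul_assoc]
    gcongr
    nlinarith [pi_gt_d4]

/-- A majorant of `circleCsc N x ^ 3` for `k - c ≤ N * ‖x‖`. The bin `k = 0` gets weight `0`
because the points summed over lie outside it. -/
noncomputable def binWeight (c : ℝ) (k : ℕ) : ℝ :=
  if k = 0 then 0 else if k ≤ 6 then (3.0958 * (k - c))⁻¹ ^ 3 else (2 * (k - c))⁻¹ ^ 3

variable {c : ℝ}

lemma binWeight_nonneg (hc : c ≤ 1) (k : ℕ) : 0 ≤ binWeight c k := by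
  rcases Nat.eq_zero_or_pos k with rfl | hk
  · simp [binWeight]
  · have hkc : 0 ≤ (k : ℝ) - c := by linarith [(by exact_mod_cast hk : (1 : ℝ) ≤ k)]
    unfold binWeight
    split_ifs <;> positivity

lemma circleCsc_pow_le_binWeight (hN : 64 ≤ N) (hc0 : 0 ≤ c) (hc1 : c < 1) {k : ℕ} (hk : 1 ≤ k)
    (h : k - c ≤ N * ‖x‖) : circleCsc N x ^ 3 ≤ binWeight c k := by
  have hk' : (1 : ℝ) ≤ k := by exact_mod_cast hk
  have hkc : 0 < (k : ℝ) - c := by linarith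
  have hcsc := circleCsc_nonneg N x
  rw [binWeight, if_neg (by omega)]
  split_ifs with hk6
  · have hk6' : (k : ℝ) ≤ 6 := by exact_mod_cast hk6
    gcongr
    exact circleCsc_le_of_le_six hN hkc (by linarith) h
  · gcongr
    exact circleCsc_le_inv_two_mul hkc h

lemma inv_pow_three_le_sub {x : ℝ} (hx : 1 / 2 < x) :
    x⁻¹ ^ 3 ≤ 1 / (2 * (x - 1 / 2) ^ 2) - 1 / (2 * (x + 1 / 2) ^ 2) := by
  have : 0 < x - 1 / 2 := by linarith
  have : 0 < x := by linarith
  have hdiff : 1 / (2 * (x - 1 / 2) ^ 2) - 1 / (2 * (x + 1 / 2) ^ 2) =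
      x / ((x - 1 / 2) ^ 2 * (x + 1 / 2) ^ 2) := by
    rw [div_sub_div _ _ (by positivity) (by positivity),
      div_eq_div_iff (by positivity) (by positivity)]
    ring
  rw [hdiff, inv_pow, inv_eq_one_div, div_le_div_iff₀ (by positivity) (by positivity)]
  nlinarith [sq_nonneg x]

lemma sum_inv_pow_three_le {a : ℝ} (ha : 1 / 2 < a) (n : ℕ) :
    ∑ k ∈ Finset.range n, ((k + a)⁻¹ : ℝ) ^ 3 ≤ 1 / (2 * (a - 1 / 2) ^ 2) := by
  have hterm : ∀ k : ℕ, ((k + a)⁻¹ : ℝ) ^ 3 ≤ 1 / (2 * (k + a - 1 / 2) ^ 2) -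
      1 / (2 * ((k + 1 : ℕ) + a - 1 / 2) ^ 2) := fun k => by
    refine (inv_pow_three_le_sub (x := k + a)
      (by linarith [Nat.cast_nonneg (α := ℝ) k])).trans_eq ?_
    push_cast
    ring_nf
  refine (Finset.sum_le_sum fun k _ => hterm k).trans ?_
  rw [Finset.sum_range_sub' fun k : ℕ => 1 / (2 * ((k : ℝ) + a - 1 / 2) ^ 2), Nat.cast_zero,
    zero_add, sub_le_self_iff]
  positivity

lemma sum_binWeight_le (hc : c ≤ 1 / 2) (n : ℕ) :
    ∑ k ∈ Finset.range n, binWeight c k ≤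
      ∑ k ∈ Finset.range 7, binWeight c k + 1 / (16 * (13 / 2 - c) ^ 2) := by
  have htail : ∀ k ∈ Finset.range n,
      binWeight c (7 + k) = 1 / 8 * ((k + (7 - c))⁻¹ : ℝ) ^ 3 := fun k _ => by
    rw [binWeight, if_neg (by omega), if_neg (by omega), mul_inv, mul_pow]
    push_cast
    rw [show (7 : ℝ) + k - c = k + (7 - c) by ring]
    norm_num
  calc _ ≤ ∑ k ∈ Finset.range (7 + n), binWeight c k :=
        Finset.sum_le_sum_of_subset_of_nonneg (Finset.range_subset_range.2 (by omega))
          fun k _ _ => binWeight_nonneg (by linarith) k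
    _ = ∑ k ∈ Finset.range 7, binWeight c k +
        1 / 8 * ∑ k ∈ Finset.range n, ((k + (7 - c))⁻¹ : ℝ) ^ 3 := by
      rw [Finset.sum_range_add, Finset.sum_congr rfl htail, Finset.mul_sum]
    _ ≤ ∑ k ∈ Finset.range 7, binWeight c k + 1 / 8 * (1 / (2 * (7 - c - 1 / 2) ^ 2)) := by
      gcongr
      exact sum_inv_pow_three_le (by linarith) n
    _ = _ := by
      rw [one_div_mul_one_div, ← mul_assoc]
      ring_nf

lemma IsUnitSeparated.sum_circleCsc_pow_le {T : Finset Torus} (hT : IsUnitSeparated N T)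
    (hN : 64 ≤ N) (hc0 : 0 ≤ c) (hc : c ≤ 1 / 2) {x y : Torus} (hy : ∀ t ∈ T, 1 ≤ N * ‖y - t‖)
    (hxy : N * ‖x - y‖ ≤ c) : ∑ t ∈ T, circleCsc N (x - t) ^ 3 ≤
      2 * (∑ k ∈ Finset.range 7, binWeight c k + 1 / (16 * (13 / 2 - c) ^ 2)) := by
  refine (Finset.sum_le_sum fun t ht => circleCsc_pow_le_binWeight hN hc0 (by linarith)
    ((Nat.one_le_floor_iff _).2 (hy t ht)) ?_).trans
    ((hT.sum_natFloor_le y (binWeight_nonneg (by linarith))).trans ?_)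
  · have hfloor := Nat.floor_le (by positivity : 0 ≤ (N : ℝ) * ‖y - t‖)
    have htri := mul_norm_sub_le_mul_norm (x := y - t) (y := x - t) (by simpa using hxy)
    linarith
  · exact mul_le_mul_of_nonneg_left (sum_binWeight_le hc _) zero_le_two

lemma IsUnitSeparated.sum_circleCsc_pow_le_of_one_le {T : Finset Torus}
    (hT : IsUnitSeparated N T) (hN : 64 ≤ N) (hx : ∀ t ∈ T, 1 ≤ N * ‖x - t‖) :
    ∑ t ∈ T, circleCsc N (x - t) ^ 3 ≤ 0.084 := by
  refine (hT.sum_circleCsc_pow_le hN le_rfl (by norm_num) hx (by simp)).trans ?_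
  simp only [Finset.sum_range_succ, Finset.sum_range_zero, binWeight]
  norm_num

lemma IsUnitSeparated.sum_circleCsc_pow_le_of_near {S : Finset Torus} (hS : IsUnitSeparated N S)
    (hN : 64 ≤ N) {s : Torus} (hs : s ∈ S) (hx : N * ‖x - s‖ ≤ 1 / 4) :
    ∑ t ∈ S.erase s, circleCsc N (x - t) ^ 3 ≤ 0.182 := by
  refine ((hS.mono (Finset.erase_subset s S)).sum_circleCsc_pow_le hN (by norm_num) (by norm_num)
    (fun t ht => hS.one_le_of_mem_erase hs ht) hx).trans ?_
  simp only [Finset.sum_range_succ, Finset.sum_range_zero, binWeight]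
  norm_num

end Decay

section CentralNode

open Real

lemma cos_le_quartic {x : ℝ} (hx : 0 ≤ x) : cos x ≤ 1 - x ^ 2 / 2 + x ^ 4 / 24 := by
  let f (t : ℝ) : ℝ := 1 - t ^ 2 / 2 + t ^ 4 / 24 - cos t
  have hderiv (t : ℝ) : deriv f t = sin t - (t - t ^ 3 / 6) := by
    simp (disch := fun_prop) [f]
    ring
  have hmono : MonotoneOn f (Set.Ici 0) := by
    apply monotoneOn_of_deriv_nonneg (convex_Ici 0) (by fun_prop) (by fun_prop)
    grind [sin_ge_sub_cube, interior_Ici]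
  have hle : f 0 ≤ f x := hmono (by simp) hx hx
  grind [cos_zero]

lemma sin_le_quintic {x : ℝ} (hx : 0 ≤ x) : sin x ≤ x - x ^ 3 / 6 + x ^ 5 / 120 := by
  let f (t : ℝ) : ℝ := t - t ^ 3 / 6 + t ^ 5 / 120 - sin t
  have hderiv (t : ℝ) : deriv f t = 1 - t ^ 2 / 2 + t ^ 4 / 24 - cos t := by
    simp (disch := fun_prop) [f]
    ring
  have hmono : MonotoneOn f (Set.Ici 0) := by
    apply monotoneOn_of_deriv_nonneg (convex_Ici 0) (by fun_prop) (by fun_prop)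
    grind [cos_le_quartic, interior_Ici]
  have hle : f 0 ≤ f x := hmono (by simp) hx hx
  grind [sin_zero]

variable {N : ℕ} {u : ℝ}

lemma scaledCsc_neg (N : ℕ) (u : ℝ) : scaledCsc N (-u) = -scaledCsc N u := by
  rw [scaledCsc, scaledCsc, mul_neg, neg_div, sin_neg, mul_neg, inv_neg]

lemma jackson_neg (N : ℕ) (u : ℝ) : jackson N (-u) = jackson N u := by
  rw [jackson, jackson, scaledCsc_neg, mul_neg, sin_neg]
  ring

lemma jacksonOdd_neg (N : ℕ) (u : ℝ) : jacksonOdd N (-u) = -jacksonOdd N u := by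
  rw [jacksonOdd, jacksonOdd, scaledCsc_neg, mul_neg, sin_neg, neg_div, cos_neg]
  ring

lemma jackson_abs (N : ℕ) (u : ℝ) : jackson N |u| = jackson N u := by
  rcases abs_choice u with h | h <;> simp only [h, jackson_neg]

lemma jackson_nonneg (N : ℕ) (u : ℝ) : 0 ≤ jackson N u := by
  rw [jackson, ← mul_pow]
  positivity

lemma sin_mul_scaledCsc_nonneg (hN : 0 < N) (hu0 : 0 ≤ u) (hu1 : u ≤ 1) :
    0 ≤ sin (π * u) * scaledCsc N u := by
  have hN' : (1 : ℝ) ≤ N := by exact_mod_cast hN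
  have hsin : 0 ≤ sin (π * u) :=
    sin_nonneg_of_nonneg_of_le_pi (by positivity) (mul_le_of_le_one_right pi_pos.le hu1)
  have hsin_div : 0 ≤ sin (π * u / N) := by
    refine sin_nonneg_of_nonneg_of_le_pi (by positivity) ?_
    rw [div_le_iff₀ (by linarith)]
    gcongr
    linarith
  rw [scaledCsc]
  positivity

lemma mul_one_sub_le_mul_sin_div (hN : 64 ≤ N) {y : ℝ} (hy : 0 ≤ y) :
    y * (1 - y ^ 2 / 24576) ≤ N * sin (y / N) := by
  have hN' : (64 : ℝ) ≤ N := by exact_mod_cast hN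
  have hsq : (y / N) ^ 2 ≤ y ^ 2 / 4096 := by
    rw [div_pow]
    gcongr
    nlinarith
  calc y * (1 - y ^ 2 / 24576) ≤ y * (1 - (y / N) ^ 2 / 6) :=
        mul_le_mul_of_nonneg_left (by linarith) hy
    _ = N * (y / N - (y / N) ^ 3 / 6) := by field_simp
    _ ≤ N * sin (y / N) := by gcongr; exact sin_ge_sub_cube (by positivity)

lemma sin_mul_scaledCsc_le (hN : 64 ≤ N) (hu : 0 < u) (hu1 : u ≤ 1 / 2) :
    sin (π * u) * scaledCsc N u ≤
      (1 - (π * u) ^ 2 / 6 + ((π * u) ^ 2) ^ 2 / 120) / (1 - (π * u) ^ 2 / 24576) := by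
  have hy : 0 < π * u := by positivity
  have hy2 : π * u ≤ 2 := by nlinarith [pi_le_four]
  have hnum : sin (π * u) ≤ π * u * (1 - (π * u) ^ 2 / 6 + ((π * u) ^ 2) ^ 2 / 120) := by
    linarith [sin_le_quintic hy.le]
  have hnum_nonneg : 0 ≤ 1 - (π * u) ^ 2 / 6 + ((π * u) ^ 2) ^ 2 / 120 := by nlinarith
  have hden_pos : 0 < 1 - (π * u) ^ 2 / 24576 := by nlinarith
  rw [scaledCsc, ← div_eq_mul_inv, ← mul_div_mul_left _ (1 - (π * u) ^ 2 / 24576) hy.ne']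
  exact div_le_div₀ (by positivity) hnum (by positivity) (mul_one_sub_le_mul_sin_div hN hy.le)

lemma le_pi_mul_sq (u : ℝ) : 9.869 * u ^ 2 ≤ (π * u) ^ 2 := by
  rw [mul_pow]
  gcongr
  nlinarith [pi_gt_d4]

lemma pi_mul_sq_le (u : ℝ) : (π * u) ^ 2 ≤ 9.87 * u ^ 2 := by
  rw [mul_pow]
  gcongr
  nlinarith [pi_lt_d4, pi_pos]

lemma one_sub_mul_pow_four_le {g : ℝ} (hg0 : 0 ≤ g) (hg : g ≤ 0.6169) :
    (1 - 0.161 * g) ^ 4 ≤ 1 - 0.5472 * g := by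
  have hg2 : 0 ≤ g ^ 2 := sq_nonneg g
  nlinarith [mul_nonneg hg0 hg2, mul_nonneg hg2 hg2, mul_nonneg hg0 (sub_nonneg.2 hg),
    mul_nonneg hg2 (sub_nonneg.2 hg), mul_nonneg (mul_nonneg hg0 hg2) (sub_nonneg.2 hg)]

lemma jackson_le_near (hN : 64 ≤ N) (hu : |u| ≤ 1 / 4) (hu0 : u ≠ 0) :
    jackson N u ≤ 1 - 5.4 * u ^ 2 := by
  rw [← jackson_abs, ← sq_abs u]
  replace hu0 := abs_pos.2 hu0
  generalize |u| = u at *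
  have hbase := sin_mul_scaledCsc_le hN hu0 (by linarith)
  have hbase_nonneg := sin_mul_scaledCsc_nonneg (N := N) (by omega) hu0.le (by linarith)
  have hg0 : 0 ≤ (π * u) ^ 2 := sq_nonneg _
  have hg_ge := le_pi_mul_sq u
  have hg_le : (π * u) ^ 2 ≤ 0.6169 := by nlinarith [pi_mul_sq_le u]
  rw [jackson, ← mul_pow]
  generalize (π * u) ^ 2 = g at *
  have hlin : sin (π * u) * scaledCsc N u ≤ 1 - 0.161 * g := by
    refine hbase.trans ?_
    rw [div_le_iff₀ (by linarith)]
    nlinarith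
  calc (sin (π * u) * scaledCsc N u) ^ 4 ≤ (1 - 0.161 * g) ^ 4 := by gcongr
    _ ≤ 1 - 0.5472 * g := one_sub_mul_pow_four_le hg0 hg_le
    _ ≤ _ := by linarith

lemma jackson_le_mid (hN : 64 ≤ N) (hu1 : 1 / 4 ≤ |u|) (hu2 : |u| ≤ 2 / 5) :
    jackson N u ≤ 0.662 := by
  rw [← jackson_abs]
  generalize |u| = u at *
  have hbase := sin_mul_scaledCsc_le hN (by linarith) (by linarith)
  have hbase_nonneg := sin_mul_scaledCsc_nonneg (N := N) (u := u) (by omega) (by linarith)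
    (by linarith)
  have hg_ge : 0.6168 ≤ (π * u) ^ 2 := by nlinarith [le_pi_mul_sq u]
  have hg_le : (π * u) ^ 2 ≤ 1.58 := by nlinarith [pi_mul_sq_le u]
  rw [jackson, ← mul_pow]
  generalize (π * u) ^ 2 = g at *
  have hle : sin (π * u) * scaledCsc N u ≤ 0.902 := by
    refine hbase.trans ?_
    rw [div_le_iff₀ (by linarith)]
    nlinarith
  calc (sin (π * u) * scaledCsc N u) ^ 4 ≤ 0.902 ^ 4 := by gcongr
    _ ≤ _ := by norm_num

lemma mul_sin_mul_cos_div_le (N : ℕ) (hu : 0 ≤ u) :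
    N * (sin (π * u / N) * cos (π * u / N)) / π ≤ u := by
  have hdouble : sin (π * u / N) * cos (π * u / N) = sin (2 * (π * u / N)) / 2 := by
    rw [sin_two_mul]; ring
  rcases N.eq_zero_or_pos with rfl | hN
  · simpa using hu
  rw [hdouble, div_le_iff₀ pi_pos]
  calc (N : ℝ) * (sin (2 * (π * u / N)) / 2) ≤ N * (2 * (π * u / N) / 2) := by
        gcongr
        exact sin_le (by positivity)
    _ = u * π := by field_simp

lemma sub_cube_le_mul_sin_mul_cos_div (hN : 64 ≤ N) (hu : 0 ≤ u) :
    u - 0.0017 * u ^ 3 ≤ N * (sin (π * u / N) * cos (π * u / N)) / π := by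
  have hN' : (64 : ℝ) ≤ N := by exact_mod_cast hN
  have hdouble : sin (π * u / N) * cos (π * u / N) = sin (2 * (π * u / N)) / 2 := by
    rw [sin_two_mul]; ring
  rw [hdouble, le_div_iff₀ pi_pos]
  have hcube : 2 / 3 * π ^ 2 * u ^ 3 / N ^ 2 ≤ 0.0017 * u ^ 3 := by
    have hN_sq : 2 / 3 * π ^ 2 ≤ 0.0017 * (N : ℝ) ^ 2 := by nlinarith [pi_lt_d4, pi_pos]
    rw [div_le_iff₀ (by positivity)]
    nlinarith [pow_nonneg hu 3]
  calc (u - 0.0017 * u ^ 3) * π ≤ (u - 2 / 3 * π ^ 2 * u ^ 3 / N ^ 2) * π := by gcongr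
    _ = N * ((2 * (π * u / N) - (2 * (π * u / N)) ^ 3 / 6) / 2) := by field_simp; ring
    _ ≤ _ := by gcongr; exact sin_ge_sub_cube (by positivity)

lemma sin_pi_mul_div_pos (hN : 0 < N) (hu0 : 0 < u) (hu1 : u < 1) : 0 < sin (π * u / N) := by
  have hN' : (1 : ℝ) ≤ N := by exact_mod_cast hN
  refine sin_pos_of_pos_of_lt_pi (by positivity) ?_
  rw [div_lt_iff₀ (by linarith)]
  nlinarith [pi_pos]

lemma abs_jacksonOdd_le_mul (hN : 64 ≤ N) (hu : |u| ≤ 1 / 2) :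
    |jacksonOdd N u| ≤ jackson N u * |u| := by
  rcases eq_or_ne u 0 with rfl | hu0
  · simp [jacksonOdd]
  wlog hpos : 0 < u generalizing u
  · have hneg := this (u := -u) (by rwa [abs_neg]) (neg_ne_zero.2 hu0) (by grind)
    rwa [jacksonOdd_neg, jackson_neg, abs_neg, abs_neg] at hneg
  rw [abs_of_pos hpos] at hu ⊢
  have hfactor : 0 ≤ N * (sin (π * u / N) * cos (π * u / N)) / π :=
    le_trans (by nlinarith [pow_pos hpos 3, pow_le_pow_left₀ hpos.le hu 2])
      (sub_cube_le_mul_sin_mul_cos_div hN hpos.le)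
  rw [jacksonOdd_eq_mul (sin_pi_mul_div_pos (by omega) hpos (by linarith)).ne',
    abs_of_nonneg (mul_nonneg (jackson_nonneg N u) hfactor)]
  gcongr
  · exact jackson_nonneg N u
  · exact mul_sin_mul_cos_div_le N hpos.le

lemma abs_jacksonOdd_sub_le (hN : 64 ≤ N) (hu : |u| ≤ 1 / 4) (hu0 : u ≠ 0) :
    |jacksonOdd N u - u| ≤ 1 / 4 * (1 - jackson N u) + 0.0005 * u ^ 2 := by
  wlog hpos : 0 < u generalizing u
  · have hneg := this (u := -u) (by rwa [abs_neg]) (neg_ne_zero.2 hu0) (by grind)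
    rwa [jacksonOdd_neg, jackson_neg, neg_sq, ← neg_sub', abs_neg] at hneg
  have hK_le : jackson N u ≤ 1 := (jackson_le_near hN hu hu0).trans (by nlinarith [sq_nonneg u])
  have hK_nonneg := jackson_nonneg N u
  rw [abs_of_pos hpos] at hu
  have hT_ge := sub_cube_le_mul_sin_mul_cos_div hN hpos.le
  have hT_le := mul_sin_mul_cos_div_le N hpos.le
  rw [jacksonOdd_eq_mul (sin_pi_mul_div_pos (by omega) hpos (by linarith)).ne']
  generalize N * (sin (π * u / N) * cos (π * u / N)) / π = T at *
  have hu_cube : u ^ 3 ≤ 1 / 4 * u ^ 2 := by nlinarith [sq_nonneg u]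
  have hT_sub : jackson N u * (u - T) ≤ 1 * (0.0017 * u ^ 3) :=
    mul_le_mul hK_le (by linarith) (by linarith) zero_le_one
  rw [abs_of_nonpos (by nlinarith)]
  nlinarith

end CentralNode

section LinearAlgebra

lemma norm_sub_sub_le_of_norm_deriv₂_le {E : Type*} [NormedAddCommGroup E] [NormedSpace ℝ E]
    {f f' f'' : ℝ → E} {B : ℝ} (hf : ∀ t ∈ Set.Icc (0 : ℝ) 1, HasDerivAt f (f' t) t)
    (hf' : ∀ t ∈ Set.Icc (0 : ℝ) 1, HasDerivAt f' (f'' t) t)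
    (hB : ∀ t ∈ Set.Icc (0 : ℝ) 1, ‖f'' t‖ ≤ B) : ‖f 1 - f 0 - f' 0‖ ≤ B / 2 := by
  have hderiv_le : ∀ t ∈ Set.Icc (0 : ℝ) 1, ‖f' t - f' 0‖ ≤ B * (t - 0) :=
    norm_image_sub_le_of_norm_deriv_le_segment' (fun t ht => (hf' t ht).hasDerivWithinAt)
      fun t ht => hB t ⟨ht.1, ht.2.le⟩
  have hremainder : ∀ t ∈ Set.Icc (0 : ℝ) 1,
      HasDerivAt (fun t => f t - f 0 - t • f' 0) (f' t - f' 0) t := fun t ht => by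
    simpa using ((hf t ht).sub_const (f 0)).fun_sub ((hasDerivAt_id t).smul_const (f' 0))
  have hbound : ∀ t : ℝ, HasDerivAt (fun t => B * t ^ 2 / 2) (B * t) t := fun t => by
    refine (((hasDerivAt_pow 2 t).const_mul B).div_const 2).congr_deriv ?_
    push_cast
    ring
  simpa using image_norm_le_of_norm_deriv_right_le_deriv_boundary
    (fun t ht => (hremainder t ht).continuousAt.continuousWithinAt)
    (fun t ht => (hremainder t ⟨ht.1, ht.2.le⟩).hasDerivWithinAt) (by simp) hbound
    (fun t ht => by simpa using hderiv_le t ⟨ht.1, ht.2.le⟩) (Set.right_mem_Icc.2 zero_le_one)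

lemma norm_taylor_le {E : Type*} [NormedAddCommGroup E] [NormedSpace ℝ E]
    {f f' f'' : ℝ → E} {r B : ℝ} (hf : ∀ t, |t| ≤ r → HasDerivAt f (f' t) t)
    (hf' : ∀ t, |t| ≤ r → HasDerivAt f' (f'' t) t) (hB : ∀ t, |t| ≤ r → ‖f'' t‖ ≤ B) {d : ℝ}
    (hd : |d| ≤ r) : ‖f d - f 0 - d • f' 0‖ ≤ B * d ^ 2 / 2 := by
  have hle : ∀ t ∈ Set.Icc (0 : ℝ) 1, |t * d| ≤ r := fun t ht => by
    rw [abs_mul, abs_of_nonneg ht.1]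
    exact (mul_le_of_le_one_left (abs_nonneg d) ht.2).trans hd
  have hscale : ∀ t : ℝ, HasDerivAt (fun t => t * d) d t := fun _ => hasDerivAt_mul_const d
  have hunit := norm_sub_sub_le_of_norm_deriv₂_le (f := fun t => f (t * d))
    (f' := fun t => d • f' (t * d)) (f'' := fun t => d • d • f'' (t * d)) (B := B * d ^ 2)
    (fun t ht => (hf _ (hle t ht)).scomp t (hscale t))
    (fun t ht => ((hf' _ (hle t ht)).scomp t (hscale t)).fun_const_smul d) fun t ht => by
      rw [smul_smul, norm_smul, Real.norm_eq_abs, abs_mul_self, ← pow_two, mul_comm]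
      exact mul_le_mul_of_nonneg_right (hB _ (hle t ht)) (sq_nonneg d)
  simpa using hunit

open Matrix

variable {ι : Type*} [Fintype ι]

lemma norm_mulVec_le {A : Matrix ι ι ℂ} {a : ℝ} (ha : ∀ i, ∑ j, ‖A i j‖ ≤ a) (x : ι → ℂ) :
    ‖A *ᵥ x‖ ≤ a * ‖x‖ := by
  rcases isEmpty_or_nonempty ι with _ | ⟨⟨i₀⟩⟩
  · simp [Subsingleton.elim x 0]
  have ha0 : 0 ≤ a := (Finset.sum_nonneg fun _ _ => norm_nonneg _).trans (ha i₀)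
  refine (pi_norm_le_iff_of_nonneg (by positivity)).2 fun i => ?_
  calc ‖∑ j, A i j * x j‖ ≤ ∑ j, ‖A i j‖ * ‖x‖ := norm_sum_le_of_le _ fun j _ => by
        rw [norm_mul]
        gcongr
        exact norm_le_pi_norm x j
    _ = (∑ j, ‖A i j‖) * ‖x‖ := (Finset.sum_mul ..).symm
    _ ≤ _ := by gcongr; exact ha i

variable {A B C D : Matrix ι ι ℂ} {a b c d k : ℝ} {v α β : ι → ℂ}

lemma norm_le_of_add_mulVec_eq_zero (hC : ∀ i, ∑ j, ‖C i j‖ ≤ c) (hD : ∀ i, ∑ j, ‖D i j‖ ≤ d)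
    (hd : d < 1) (h : β + (C *ᵥ α + D *ᵥ β) = 0) : ‖β‖ ≤ c / (1 - d) * ‖α‖ := by
  have hβ : ‖β‖ ≤ c * ‖α‖ + d * ‖β‖ :=
    calc ‖β‖ = ‖C *ᵥ α + D *ᵥ β‖ := by rw [eq_neg_of_add_eq_zero_right h, norm_neg]
      _ ≤ _ := norm_add_le_of_le (norm_mulVec_le hC α) (norm_mulVec_le hD β)
  rw [div_mul_eq_mul_div, le_div_iff₀ (by linarith)]
  linarith

lemma norm_sub_le_of_add_mulVec_eq (hA : ∀ i, ∑ j, ‖A i j‖ ≤ a) (hB : ∀ i, ∑ j, ‖B i j‖ ≤ b)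
    (hb : 0 ≤ b) (hβ : ‖β‖ ≤ k * ‖α‖) (h : α + (A *ᵥ α + B *ᵥ β) = v) :
    ‖α - v‖ ≤ (a + b * k) * ‖α‖ :=
  calc ‖α - v‖ = ‖A *ᵥ α + B *ᵥ β‖ := by rw [← h, sub_add_cancel_left, norm_neg]
    _ ≤ a * ‖α‖ + b * ‖β‖ := norm_add_le_of_le (norm_mulVec_le hA α) (norm_mulVec_le hB β)
    _ ≤ a * ‖α‖ + b * (k * ‖α‖) := by gcongr
    _ = _ := by ring

lemma norm_le_inv_mul_of_norm_sub_le {E : Type*} [SeminormedAddCommGroup E] {x y : E} {ρ : ℝ}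
    (hρ : ρ < 1) (h : ‖x - y‖ ≤ ρ * ‖x‖) : ‖x‖ ≤ (1 - ρ)⁻¹ * ‖y‖ := by
  rw [inv_mul_eq_div, le_div_iff₀ (by linarith)]
  linarith [norm_sub_norm_le x y]

lemma exists_block_solution (hA : ∀ i, ∑ j, ‖A i j‖ ≤ a) (hB : ∀ i, ∑ j, ‖B i j‖ ≤ b)
    (hC : ∀ i, ∑ j, ‖C i j‖ ≤ c) (hD : ∀ i, ∑ j, ‖D i j‖ ≤ d) (hb : 0 ≤ b) (hd : d < 1)
    (hρ : a + b * (c / (1 - d)) < 1) (v : ι → ℂ) :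
    ∃ α β : ι → ℂ, α + (A *ᵥ α + B *ᵥ β) = v ∧ β + (C *ᵥ α + D *ᵥ β) = 0 := by
  classical
  have hinj : Function.Injective (1 + fromBlocks A B C D).mulVecLin := by
    rw [← LinearMap.ker_eq_bot, LinearMap.ker_eq_bot']
    intro x hx
    obtain ⟨⟨α, β⟩, rfl⟩ := (Equiv.sumArrowEquivProdArrow ι ι ℂ).symm.surjective x
    rw [mulVecLin_apply, add_mulVec, one_mulVec, fromBlocks_mulVec] at hx
    have hfst : α + (A *ᵥ α + B *ᵥ β) = 0 := funext fun i => congrFun hx (Sum.inl i)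
    have hsnd : β + (C *ᵥ α + D *ᵥ β) = 0 := funext fun i => congrFun hx (Sum.inr i)
    have hβ := norm_le_of_add_mulVec_eq_zero hC hD hd hsnd
    have hα := norm_le_inv_mul_of_norm_sub_le hρ (norm_sub_le_of_add_mulVec_eq hA hB hb hβ hfst)
    rw [norm_zero, mul_zero, norm_le_zero_iff] at hα
    rw [hα, norm_zero, mul_zero, norm_le_zero_iff] at hβ
    rw [hα, hβ]
    exact funext fun i => by cases i <;> rfl
  obtain ⟨x, hx⟩ := LinearMap.injective_iff_surjective.1 hinj (Sum.elim v 0)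
  rw [mulVecLin_apply, add_mulVec, one_mulVec, fromBlocks_mulVec] at hx
  exact ⟨x ∘ Sum.inl, x ∘ Sum.inr, funext fun i => congrFun hx (Sum.inl i),
    funext fun i => congrFun hx (Sum.inr i)⟩

end LinearAlgebra

section Interpolation

open Real Matrix

variable {N : ℕ} {S : Finset Torus}

/-- The coordinate `u = N t` of a point of the circle, where `t ∈ [-1/2, 1/2]` is a representative
of the point. -/
noncomputable def scaledLift (N : ℕ) (x : Torus) : ℝ := N * (exists_coe_eq_abs_eq_norm x).choose

lemma abs_scaledLift (N : ℕ) (x : Torus) : |scaledLift N x| = N * ‖x‖ := by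
  rw [scaledLift, abs_mul, (exists_coe_eq_abs_eq_norm x).choose_spec.2, Nat.abs_cast]

lemma coe_scaledLift_div (hN : 0 < N) (x : Torus) : ((scaledLift N x / N : ℝ) : Torus) = x := by
  rw [scaledLift, mul_div_cancel_left₀ _ (Nat.cast_ne_zero.2 hN.ne')]
  exact (exists_coe_eq_abs_eq_norm x).choose_spec.1

lemma coe_scaledLift_add_div (hN : 0 < N) (x : Torus) (y : ℝ) :
    (((scaledLift N x + y) / N : ℝ) : Torus) = x + ((y / N : ℝ) : Torus) := by
  rw [add_div, AddCircle.coe_add, coe_scaledLift_div hN]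

lemma mul_norm_coe_div_le (N : ℕ) (y : ℝ) : N * ‖((y / N : ℝ) : Torus)‖ ≤ |y| := by
  rcases N.eq_zero_or_pos with rfl | hN
  · simp
  calc N * ‖((y / N : ℝ) : Torus)‖ ≤ N * |y / N| := by
        gcongr
        exact QuotientAddGroup.norm_mk_le_norm
    _ = |y| := by rw [abs_div, Nat.abs_cast, mul_div_cancel₀ _ (Nat.cast_ne_zero.2 hN.ne')]

/-- The combination of the Jackson kernel and its odd companion, translated to the nodes `S`,
with coefficients `α` and `β`. -/
noncomputable def kernelSum (N : ℕ) (S : Finset Torus) (α β : Torus → ℂ) : C(Torus, ℂ) :=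
  ∑ t ∈ S, (α t • (jacksonCircle N).comp (ContinuousMap.addRight (-t)) +
    β t • (jacksonOddCircle N).comp (ContinuousMap.addRight (-t)))

lemma kernelSum_apply (N : ℕ) (S : Finset Torus) (α β : Torus → ℂ) (x : Torus) :
    kernelSum N S α β x =
      ∑ t ∈ S, (α t * jacksonCircle N (x - t) + β t * jacksonOddCircle N (x - t)) := by
  simp [kernelSum, sub_eq_add_neg]

lemma kernelSum_mem_trigPoly (N : ℕ) (S : Finset Torus) (α β : Torus → ℂ) :
    kernelSum N S α β ∈ trigPoly (2 * (N - 1) + 1) :=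
  Submodule.sum_mem _ fun _ _ => Submodule.add_mem _
    (Submodule.smul_mem _ _ (comp_addRight_mem_trigPoly
      (trigPoly_mono (Nat.le_succ _) (jacksonCircle_mem_trigPoly N)) _))
    (Submodule.smul_mem _ _ (comp_addRight_mem_trigPoly (jacksonOddCircle_mem_trigPoly N) _))

/-- The contribution at `s + y / N` of the nodes other than `s` to a combination of translates of
two functions `F` and `G` of the coordinate `u = N x`. -/
noncomputable def offNodeSum (N : ℕ) (S : Finset Torus) (α β : Torus → ℂ) (s : Torus)
    (F G : ℝ → ℝ) (y : ℝ) : ℂ :=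
  ∑ t ∈ S.erase s, (α t * F (scaledLift N (s - t) + y) + β t * G (scaledLift N (s - t) + y))

/-- The coefficients `α`, `β` make `kernelSum N S α β` take the value `v s` with vanishing
derivative at each node `s ∈ S`, and are close to `v` and `0` respectively. -/
structure IsKernelInterpolation (N : ℕ) (S : Finset Torus) (v α β : Torus → ℂ) : Prop where
  value_eq : ∀ s ∈ S, α s + offNodeSum N S α β s (jackson N) (jacksonOdd N) 0 = v s
  deriv_eq : ∀ s ∈ S, β s + offNodeSum N S α β s (jacksonDeriv N) (jacksonOddDeriv N) 0 = 0
  norm_sub_le : ∀ s ∈ S, ‖α s - v s‖ ≤ 0.036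
  norm_snd_le : ∀ s ∈ S, ‖β s‖ ≤ 0.28

lemma IsKernelInterpolation.norm_fst_le {v α β : Torus → ℂ}
    (h : IsKernelInterpolation N S v α β) (hv : ∀ s, ‖v s‖ ≤ 1) {s : Torus} (hs : s ∈ S) :
    ‖α s‖ ≤ 1.036 := by
  linarith [norm_sub_norm_le (α s) (v s), hv s, h.norm_sub_le s hs]

/-- The matrix of values of `F` at the differences of distinct nodes. -/
noncomputable def nodeMatrix (N : ℕ) (S : Finset Torus) (F : ℝ → ℝ) : Matrix S S ℂ :=
  fun i j => if (i : Torus) ≠ j then (F (scaledLift N (i - j)) : ℂ) else 0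

lemma nodeMatrix_mulVec (N : ℕ) (S : Finset Torus) (F : ℝ → ℝ) (x : Torus → ℂ) (i : S) :
    (nodeMatrix N S F *ᵥ fun j => x j) i = ∑ t ∈ S.erase i, x t * F (scaledLift N (i - t)) := by
  rw [← Finset.filter_ne, Finset.sum_filter, ← Finset.sum_coe_sort S]
  refine Finset.sum_congr rfl fun j _ => ?_
  simp only [nodeMatrix, ite_mul, zero_mul, mul_comm (x _)]

lemma sum_norm_nodeMatrix (N : ℕ) (S : Finset Torus) (F : ℝ → ℝ) (i : S) :
    ∑ j, ‖nodeMatrix N S F i j‖ = ∑ t ∈ S.erase i, |F (scaledLift N (i - t))| := by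
  rw [← Finset.filter_ne, Finset.sum_filter, ← Finset.sum_coe_sort S]
  refine Finset.sum_congr rfl fun j _ => ?_
  rw [nodeMatrix, apply_ite norm, norm_zero, Complex.norm_real, Real.norm_eq_abs]

lemma sum_norm_nodeMatrix_le (hN : 64 ≤ N) (hS : IsUnitSeparated N S) {F : ℝ → ℝ} {c : ℝ}
    (hc : 0 ≤ c) (hF : ∀ u, |scaledCsc N u| ≤ 0.3185 → sin (π * u / N) ≠ 0 →
      |F u| ≤ c * |scaledCsc N u| ^ 3) (i : S) :
    ∑ j, ‖nodeMatrix N S F i j‖ ≤ c * 0.084 := by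
  have hfar : ∀ t ∈ S.erase i, 1 ≤ N * ‖i - t‖ := fun t => hS.one_le_of_mem_erase i.2
  calc ∑ j, ‖nodeMatrix N S F i j‖ = ∑ t ∈ S.erase i, |F (scaledLift N (i - t))| :=
        sum_norm_nodeMatrix N S F i
    _ ≤ ∑ t ∈ S.erase i, c * circleCsc N (i - t) ^ 3 := by
      refine Finset.sum_le_sum fun t ht => ?_
      have hcoe := coe_scaledLift_div (by omega : 0 < N) (i - t)
      have hcsc : |scaledCsc N (scaledLift N (i - t))| = circleCsc N (i - t) := by
        rw [abs_scaledCsc, hcoe]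
      rw [← hcsc]
      refine hF _ ?_ (sin_pi_mul_div_ne_zero ?_)
      · rw [hcsc]
        exact (circleCsc_le_of_le_one hN one_pos le_rfl (hfar t ht)).trans (by norm_num)
      · rw [hcoe]
        exact sub_ne_zero.2 (Finset.ne_of_mem_erase ht).symm
    _ ≤ c * 0.084 := by
      rw [← Finset.mul_sum]
      gcongr
      exact (hS.mono (Finset.erase_subset _ S)).sum_circleCsc_pow_le_of_one_le hN hfar

lemma sum_norm_nodeMatrix_jackson_le (hN : 64 ≤ N) (hS : IsUnitSeparated N S) (i : S) :
    ∑ j, ‖nodeMatrix N S (jackson N) i j‖ ≤ 0.027 := by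
  refine (sum_norm_nodeMatrix_le hN hS (c := 0.3185) (by norm_num) (fun u hu _ => ?_) i).trans
    (by norm_num)
  refine (abs_jackson_le N u).trans ?_
  rw [pow_succ']
  gcongr

lemma sum_norm_nodeMatrix_jacksonOdd_le (hN : 64 ≤ N) (hS : IsUnitSeparated N S) (i : S) :
    ∑ j, ‖nodeMatrix N S (jacksonOdd N) i j‖ ≤ 0.027 := by
  refine (sum_norm_nodeMatrix_le hN hS (c := π⁻¹) (by positivity) (fun u _ _ => ?_) i).trans ?_
  · rw [inv_mul_eq_div]
    exact abs_jacksonOdd_le N u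
  · rw [inv_mul_le_iff₀ pi_pos]
    linarith [pi_gt_d4]

lemma sum_norm_nodeMatrix_jacksonDeriv_le (hN : 64 ≤ N) (hS : IsUnitSeparated N S) (i : S) :
    ∑ j, ‖nodeMatrix N S (jacksonDeriv N) i j‖ ≤ 0.217 := by
  refine (sum_norm_nodeMatrix_le hN hS (c := 4 * π * 0.3185 * 0.6435) (by positivity)
    (fun u hu _ => ?_) i).trans (by linarith [pi_lt_d4])
  refine (abs_jacksonDeriv_le N u).trans ?_
  rw [pow_succ']
  calc _ ≤ 4 * π * (0.3185 * |scaledCsc N u| ^ 3) * (0.325 + 0.3185) := by gcongr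
    _ = _ := by ring

lemma sum_norm_nodeMatrix_jacksonOddDeriv_le (hN : 64 ≤ N) (hS : IsUnitSeparated N S) (i : S) :
    ∑ j, ‖nodeMatrix N S (jacksonOddDeriv N) i j‖ ≤ 0.19 := by
  refine (sum_norm_nodeMatrix_le hN hS (c := 1.3 + 3 * 0.3185) (by norm_num)
    (fun u hu hsin => ?_) i).trans (by norm_num)
  refine (abs_jacksonOddDeriv_le hsin).trans ?_
  rw [pow_succ' _ 3]
  calc _ ≤ 1.3 * |scaledCsc N u| ^ 3 + 3 * (0.3185 * |scaledCsc N u| ^ 3) := by gcongr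
    _ = _ := by ring

lemma add_offNodeSum_zero (N : ℕ) (S : Finset Torus) (γ α β : Torus → ℂ) (F G : ℝ → ℝ) (i : S) :
    γ i + offNodeSum N S α β i F G 0 = ((fun j : S => γ j) + ((nodeMatrix N S F *ᵥ fun j => α j) +
      nodeMatrix N S G *ᵥ fun j => β j)) i := by
  rw [Pi.add_apply, Pi.add_apply, nodeMatrix_mulVec, nodeMatrix_mulVec, ← Finset.sum_add_distrib]
  simp only [offNodeSum, add_zero]

lemma IsUnitSeparated.exists_isKernelInterpolation (hS : IsUnitSeparated N S) (hN : 64 ≤ N)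
    {v : Torus → ℂ} (hv : ∀ s, ‖v s‖ ≤ 1) : ∃ α β, IsKernelInterpolation N S v α β := by
  have hJ := sum_norm_nodeMatrix_jackson_le hN hS
  have hO := sum_norm_nodeMatrix_jacksonOdd_le hN hS
  have hJ' := sum_norm_nodeMatrix_jacksonDeriv_le hN hS
  have hO' := sum_norm_nodeMatrix_jacksonOddDeriv_le hN hS
  obtain ⟨α, β, hvalue, hderiv⟩ := exists_block_solution hJ hO hJ' hO' (by norm_num)
    (by norm_num) (by norm_num) fun i : S => v i
  have hv_norm : ‖fun i : S => v i‖ ≤ 1 :=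
    (pi_norm_le_iff_of_nonneg zero_le_one).2 fun i => hv i
  have hβα := norm_le_of_add_mulVec_eq_zero hJ' hO' (by norm_num) hderiv
  have hαv := norm_sub_le_of_add_mulVec_eq hJ hO (by norm_num) hβα hvalue
  have hα : ‖α‖ ≤ 1.0355 :=
    (norm_le_inv_mul_of_norm_sub_le (by norm_num) hαv).trans
      ((mul_le_of_le_one_right (by norm_num) hv_norm).trans (by norm_num))
  have hext : ∀ γ : S → ℂ, ∃ γ' : Torus → ℂ, (fun j : S => γ' j) = γ := fun γ =>
    ⟨Function.extend Subtype.val γ 0, Function.extend_comp Subtype.val_injective γ 0⟩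
  obtain ⟨α, rfl⟩ := hext α
  obtain ⟨β, rfl⟩ := hext β
  refine ⟨α, β, fun s hs => ?_, fun s hs => ?_, fun s hs => ?_, fun s hs => ?_⟩
  · exact (add_offNodeSum_zero N S α α β _ _ ⟨s, hs⟩).trans (congrFun hvalue ⟨s, hs⟩)
  · exact (add_offNodeSum_zero N S β α β _ _ ⟨s, hs⟩).trans (congrFun hderiv ⟨s, hs⟩)
  · exact (norm_le_pi_norm ((fun j : S => α j) - fun i : S => v i) ⟨s, hs⟩).trans
      (hαv.trans (by linarith))
  · exact (norm_le_pi_norm (fun j : S => β j) ⟨s, hs⟩).trans (hβα.trans (by linarith))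

end Interpolation

section NearBound

open Real

variable {N : ℕ} {S : Finset Torus} {v α β : Torus → ℂ} {s t : Torus} {y : ℝ}

lemma norm_central_le (hN : 64 ≤ N) (hy : |y| ≤ 1 / 4) (hy0 : y ≠ 0) {v α β : ℂ} (hv : ‖v‖ ≤ 1)
    (hα : ‖α - v‖ ≤ 0.036) (hβ : ‖β‖ ≤ 0.28) :
    ‖v + α * ((jackson N y : ℂ) - 1) + β * ((jacksonOdd N y : ℂ) - y)‖ ≤ 1 - 4.8 * y ^ 2 := by
  have hle := jackson_le_near hN hy hy0
  have hodd := abs_jacksonOdd_sub_le hN hy hy0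
  have hnonneg := jackson_nonneg N y
  have hsub : 0 ≤ 1 - jackson N y := by linarith [sq_nonneg y]
  have hregroup : v + α * ((jackson N y : ℂ) - 1) + β * ((jacksonOdd N y : ℂ) - y) =
      v * (jackson N y : ℂ) - (α - v) * ((1 - jackson N y : ℝ) : ℂ) +
        β * ((jacksonOdd N y - y : ℝ) : ℂ) := by
    push_cast
    ring
  rw [hregroup]
  calc _ ≤ ‖v‖ * jackson N y + ‖α - v‖ * (1 - jackson N y) + ‖β‖ * |jacksonOdd N y - y| := by
        refine (norm_add_le_of_le (norm_sub_le _ _) le_rfl).trans_eq ?_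
        simp only [norm_mul, Complex.norm_real, Real.norm_eq_abs, abs_of_nonneg hnonneg,
          abs_of_nonneg hsub]
    _ ≤ 1 * jackson N y + 0.036 * (1 - jackson N y) +
        0.28 * (1 / 4 * (1 - jackson N y) + 0.0005 * y ^ 2) := by gcongr
    _ ≤ 1 - 4.8 * y ^ 2 := by nlinarith

lemma IsUnitSeparated.le_mul_norm_scaledLift_add (hS : IsUnitSeparated N S) (hN : 0 < N)
    (hs : s ∈ S) (ht : t ∈ S.erase s) (hy : |y| ≤ 1 / 4) :
    3 / 4 ≤ N * ‖(((scaledLift N (s - t) + y) / N : ℝ) : Torus)‖ := by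
  have hone := hS.one_le_of_mem_erase hs ht
  have hshift := mul_norm_sub_le_mul_norm (N := N) (c := 1 / 4) (x := s - t)
    (y := (((scaledLift N (s - t) + y) / N : ℝ) : Torus)) (by
      rw [coe_scaledLift_add_div hN, add_sub_cancel_left]
      exact (mul_norm_coe_div_le N y).trans hy)
  linarith

lemma IsUnitSeparated.sin_scaledLift_add_ne_zero (hS : IsUnitSeparated N S) (hN : 0 < N)
    (hs : s ∈ S) (ht : t ∈ S.erase s) (hy : |y| ≤ 1 / 4) :
    sin (π * (scaledLift N (s - t) + y) / N) ≠ 0 := by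
  refine sin_pi_mul_div_ne_zero fun h => ?_
  have hle := hS.le_mul_norm_scaledLift_add hN hs ht hy
  rw [h, norm_zero, mul_zero] at hle
  norm_num at hle

lemma IsUnitSeparated.abs_scaledCsc_scaledLift_add_le (hS : IsUnitSeparated N S) (hN : 64 ≤ N)
    (hs : s ∈ S) (ht : t ∈ S.erase s) (hy : |y| ≤ 1 / 4) :
    |scaledCsc N (scaledLift N (s - t) + y)| ≤ 0.425 := by
  rw [abs_scaledCsc]
  exact (circleCsc_le_of_le_one hN (by norm_num) (by norm_num)
    (hS.le_mul_norm_scaledLift_add (by omega) hs ht hy)).trans (by norm_num)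

lemma hasDerivAt_offNodeSum {F F' G G' : ℝ → ℝ}
    (hF : ∀ t ∈ S.erase s,
      HasDerivAt F (F' (scaledLift N (s - t) + y)) (scaledLift N (s - t) + y))
    (hG : ∀ t ∈ S.erase s,
      HasDerivAt G (G' (scaledLift N (s - t) + y)) (scaledLift N (s - t) + y)) :
    HasDerivAt (offNodeSum N S α β s F G) (offNodeSum N S α β s F' G' y) y :=
  HasDerivAt.fun_sum fun t ht =>
    (((hF t ht).comp_const_add _ y).ofReal_comp.const_mul (α t)).fun_add
      (((hG t ht).comp_const_add _ y).ofReal_comp.const_mul (β t))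

lemma norm_jacksonDeriv₂_add_le {u : ℝ} (hsin : sin (π * u / N) ≠ 0) (hu : |scaledCsc N u| ≤ 0.425)
    {a b : ℂ} (ha : ‖a‖ ≤ 1.036) (hb : ‖b‖ ≤ 0.28) :
    ‖a * jacksonDeriv₂ N u + b * jacksonOddDeriv₂ N u‖ ≤ 43.1 * |scaledCsc N u| ^ 3 := by
  have hJ := abs_jacksonDeriv₂_le hsin (hu.trans (by norm_num))
  have hO := abs_jacksonOddDeriv₂_le hsin (hu.trans (by norm_num))
  rw [pow_succ' _ 3] at hJ
  calc _ ≤ ‖a‖ * |jacksonDeriv₂ N u| + ‖b‖ * |jacksonOddDeriv₂ N u| := by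
        refine (norm_add_le _ _).trans_eq ?_
        simp only [norm_mul, Complex.norm_real, Real.norm_eq_abs]
    _ ≤ 1.036 * (4 * π ^ 2 * (0.425 * |scaledCsc N u| ^ 3) * (1 + 2.6 * 0.425)) +
        0.28 * (4 * π * |scaledCsc N u| ^ 3 * (1 + 1.95 * 0.425)) := by
      gcongr
      · exact hJ.trans (by gcongr)
      · exact hO.trans (by gcongr)
    _ = (1.036 * (4 * π ^ 2 * 0.425 * (1 + 2.6 * 0.425)) +
        0.28 * (4 * π * (1 + 1.95 * 0.425))) * |scaledCsc N u| ^ 3 := by ring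
    _ ≤ 43.1 * |scaledCsc N u| ^ 3 := by
      gcongr
      nlinarith [pi_gt_d4, pi_lt_d4]

lemma IsKernelInterpolation.norm_offNodeSum_deriv₂_le (h : IsKernelInterpolation N S v α β)
    (hS : IsUnitSeparated N S) (hN : 64 ≤ N) (hv : ∀ s, ‖v s‖ ≤ 1) (hs : s ∈ S)
    (hy : |y| ≤ 1 / 4) :
    ‖offNodeSum N S α β s (jacksonDeriv₂ N) (jacksonOddDeriv₂ N) y‖ ≤ 7.85 := by
  have hN0 : 0 < N := by omega
  have hcsc : ∀ t, |scaledCsc N (scaledLift N (s - t) + y)| =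
      circleCsc N (s + ((y / N : ℝ) : Torus) - t) := fun t => by
    rw [abs_scaledCsc, coe_scaledLift_add_div hN0, add_sub_right_comm]
  have hnear : N * ‖s + ((y / N : ℝ) : Torus) - s‖ ≤ 1 / 4 := by
    rw [add_sub_cancel_left]
    exact (mul_norm_coe_div_le N y).trans hy
  calc _ ≤ ∑ t ∈ S.erase s, 43.1 * circleCsc N (s + ((y / N : ℝ) : Torus) - t) ^ 3 :=
        norm_sum_le_of_le _ fun t ht => by
          rw [← hcsc t]
          have htS := Finset.mem_of_mem_erase ht
          exact norm_jacksonDeriv₂_add_le (hS.sin_scaledLift_add_ne_zero hN0 hs ht hy)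
            (hS.abs_scaledCsc_scaledLift_add_le hN hs ht hy) (h.norm_fst_le hv htS)
            (h.norm_snd_le t htS)
    _ = 43.1 * ∑ t ∈ S.erase s, circleCsc N (s + ((y / N : ℝ) : Torus) - t) ^ 3 :=
      (Finset.mul_sum ..).symm
    _ ≤ 43.1 * 0.182 := by
      gcongr
      exact hS.sum_circleCsc_pow_le_of_near hN hs hnear
    _ ≤ 7.85 := by norm_num

lemma IsKernelInterpolation.norm_offNodeSum_sub_le (h : IsKernelInterpolation N S v α β)
    (hS : IsUnitSeparated N S) (hN : 64 ≤ N) (hv : ∀ s, ‖v s‖ ≤ 1) (hs : s ∈ S)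
    (hy : |y| ≤ 1 / 4) :
    ‖offNodeSum N S α β s (jackson N) (jacksonOdd N) y - (v s - α s) + y * β s‖ ≤
      3.925 * y ^ 2 := by
  have hsin : ∀ y : ℝ, |y| ≤ 1 / 4 → ∀ t ∈ S.erase s, _ := fun y hy t ht =>
    hS.sin_scaledLift_add_ne_zero (by omega) hs ht hy
  have htaylor := norm_taylor_le (r := 1 / 4) (B := 7.85)
    (fun y hy => hasDerivAt_offNodeSum (α := α) (β := β)
      (fun t ht => hasDerivAt_jackson (hsin y hy t ht))
      (fun t ht => hasDerivAt_jacksonOdd (hsin y hy t ht)))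
    (fun y hy => hasDerivAt_offNodeSum
      (fun t ht => hasDerivAt_jacksonDeriv (hsin y hy t ht))
      (fun t ht => hasDerivAt_jacksonOddDeriv (hsin y hy t ht)))
    (fun y hy => h.norm_offNodeSum_deriv₂_le hS hN hv hs hy) hy
  rw [eq_sub_of_add_eq' (h.value_eq s hs), eq_neg_of_add_eq_zero_right (h.deriv_eq s hs),
    Complex.real_smul, mul_neg, sub_neg_eq_add] at htaylor
  exact htaylor.trans_eq (by ring)

lemma kernelSum_add_coe_div (hN : 0 < N) (hs : s ∈ S)
    (hsin : ∀ t ∈ S.erase s, sin (π * (scaledLift N (s - t) + y) / N) ≠ 0) :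
    kernelSum N S α β (s + ((y / N : ℝ) : Torus)) =
      α s * jacksonCircle N ((y / N : ℝ) : Torus) +
        β s * jacksonOddCircle N ((y / N : ℝ) : Torus) +
        offNodeSum N S α β s (jackson N) (jacksonOdd N) y := by
  rw [kernelSum_apply, ← Finset.add_sum_erase S _ hs, add_sub_cancel_left, offNodeSum]
  congr 1
  refine Finset.sum_congr rfl fun t ht => ?_
  rw [add_sub_right_comm, ← coe_scaledLift_add_div hN, jacksonCircle_coe (hsin t ht),
    jacksonOddCircle_coe (hsin t ht)]

lemma IsKernelInterpolation.kernelSum_apply_of_mem (h : IsKernelInterpolation N S v α β)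
    (hS : IsUnitSeparated N S) (hN : 0 < N) (hs : s ∈ S) : kernelSum N S α β s = v s := by
  have hzero := kernelSum_add_coe_div (α := α) (β := β) (y := 0) hN hs fun t ht =>
    hS.sin_scaledLift_add_ne_zero hN hs ht (by norm_num)
  rwa [zero_div, AddCircle.coe_zero, add_zero, jacksonCircle_zero hN, jacksonOddCircle_zero,
    mul_one, mul_zero, add_zero, h.value_eq s hs] at hzero

lemma IsKernelInterpolation.norm_kernelSum_add_le (h : IsKernelInterpolation N S v α β)
    (hS : IsUnitSeparated N S) (hN : 64 ≤ N) (hv : ∀ s, ‖v s‖ ≤ 1) (hs : s ∈ S)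
    (hy : |y| ≤ 1 / 4) (hcoe : ((y / N : ℝ) : Torus) ≠ 0) :
    ‖kernelSum N S α β (s + ((y / N : ℝ) : Torus))‖ ≤ 1 - 0.3 * y ^ 2 := by
  have hsin := sin_pi_mul_div_ne_zero hcoe
  have hy0 : y ≠ 0 := fun hy0 => hcoe (by rw [hy0, zero_div, AddCircle.coe_zero])
  have hsplit : kernelSum N S α β (s + ((y / N : ℝ) : Torus)) =
      (v s + α s * ((jackson N y : ℂ) - 1) + β s * ((jacksonOdd N y : ℂ) - y)) +
        (offNodeSum N S α β s (jackson N) (jacksonOdd N) y - (v s - α s) + y * β s) := by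
    rw [kernelSum_add_coe_div (by omega) hs fun t ht =>
      hS.sin_scaledLift_add_ne_zero (by omega) hs ht hy, jacksonCircle_coe hsin,
      jacksonOddCircle_coe hsin]
    ring
  rw [hsplit]
  refine (norm_add_le_of_le
    (norm_central_le hN hy hy0 (hv s) (h.norm_sub_le s hs) (h.norm_snd_le s hs))
    (h.norm_offNodeSum_sub_le hS hN hv hs hy)).trans ?_
  linarith [sq_nonneg y]

lemma IsKernelInterpolation.norm_kernelSum_le_near (h : IsKernelInterpolation N S v α β)
    (hS : IsUnitSeparated N S) (hN : 64 ≤ N) (hv : ∀ s, ‖v s‖ ≤ 1) (hs : s ∈ S) {x : Torus}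
    (hx : N * ‖x - s‖ ≤ 1 / 4) :
    ‖kernelSum N S α β x‖ ≤ 1 - 0.3 * (N * ‖x - s‖) ^ 2 := by
  have hN0 : 0 < N := by omega
  rcases eq_or_ne x s with rfl | hxs
  · simpa [h.kernelSum_apply_of_mem hS hN0 hs] using hv x
  · have hcoe := coe_scaledLift_div hN0 (x - s)
    rw [← abs_scaledLift] at hx ⊢
    rw [sq_abs]
    have hle := h.norm_kernelSum_add_le hS hN hv hs hx (by rwa [hcoe, sub_ne_zero])
    rwa [hcoe, add_sub_cancel] at hle

end NearBound

section FarBound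

open Real

variable {N : ℕ} {S T : Finset Torus} {x : Torus}

section Term

variable {a b : ℂ}

lemma norm_jackson_add_le (hN : 0 < N) (ha : ‖a‖ ≤ 1.036) (hb : ‖b‖ ≤ 0.28) (hx : x ≠ 0) :
    ‖a * jacksonCircle N x + b * jacksonOddCircle N x‖ ≤
      1.036 * jackson N (scaledLift N x) + 0.28 * |jacksonOdd N (scaledLift N x)| := by
  have hcoe := coe_scaledLift_div hN x
  have hsin := sin_pi_mul_div_ne_zero (N := N) (u := scaledLift N x) (by rwa [hcoe])
  have heven := jacksonCircle_coe hsin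
  have hodd := jacksonOddCircle_coe hsin
  rw [hcoe] at heven hodd
  have hnonneg := jackson_nonneg N (scaledLift N x)
  rw [heven, hodd]
  calc _ ≤ ‖a‖ * jackson N (scaledLift N x) + ‖b‖ * |jacksonOdd N (scaledLift N x)| := by
        refine (norm_add_le _ _).trans_eq ?_
        simp only [norm_mul, Complex.norm_real, Real.norm_eq_abs, abs_of_nonneg hnonneg]
    _ ≤ _ := by gcongr

lemma norm_jackson_add_le_circleCsc (hN : 0 < N) (ha : ‖a‖ ≤ 1.036) (hb : ‖b‖ ≤ 0.28) (hx : x ≠ 0) :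
    ‖a * jacksonCircle N x + b * jacksonOddCircle N x‖ ≤
      (1.036 * circleCsc N x + 0.0892) * circleCsc N x ^ 3 := by
  have heven := (le_abs_self _).trans (abs_jackson_le N (scaledLift N x))
  have hodd := abs_jacksonOdd_le N (scaledLift N x)
  rw [abs_scaledCsc, coe_scaledLift_div hN] at heven hodd
  have hcsc := circleCsc_nonneg N x
  have hπ : 0.28 / π ≤ 0.0892 := by
    rw [div_le_iff₀ pi_pos]
    linarith [pi_gt_d4]
  calc _ ≤ 1.036 * circleCsc N x ^ 4 + 0.28 * (circleCsc N x ^ 3 / π) :=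
        (norm_jackson_add_le hN ha hb hx).trans (by gcongr)
    _ = (1.036 * circleCsc N x + 0.28 / π) * circleCsc N x ^ 3 := by ring
    _ ≤ _ := by gcongr

lemma ne_zero_of_le_mul_norm {r : ℝ} (hr : 0 < r) (h : r ≤ N * ‖x‖) : x ≠ 0 := by
  rintro rfl
  rw [norm_zero, mul_zero] at h
  linarith

lemma norm_jackson_add_le_of_le_mul_norm (hN : 64 ≤ N) (ha : ‖a‖ ≤ 1.036) (hb : ‖b‖ ≤ 0.28) {r : ℝ}
    (hr : 0 < r) (hr1 : r ≤ 1) (h : r ≤ N * ‖x‖) :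
    ‖a * jacksonCircle N x + b * jacksonOddCircle N x‖ ≤
      (1.036 * (3.1402 * r)⁻¹ + 0.0892) * (3.1402 * r)⁻¹ ^ 3 := by
  have hcsc := circleCsc_nonneg N x
  have hle := circleCsc_le_of_le_one hN hr hr1 h
  exact (norm_jackson_add_le_circleCsc (by omega) ha hb (ne_zero_of_le_mul_norm hr h)).trans
    (by gcongr)

lemma norm_jackson_add_le_of_two_fifths_le (hN : 64 ≤ N) (ha : ‖a‖ ≤ 1.036) (hb : ‖b‖ ≤ 0.28)
    (h : 2 / 5 ≤ N * ‖x‖) : ‖a * jacksonCircle N x + b * jacksonOddCircle N x‖ ≤ 0.464 :=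
  (norm_jackson_add_le_of_le_mul_norm hN ha hb (by norm_num) (by norm_num) h).trans (by norm_num)

lemma norm_jackson_add_le_of_three_fifths_le (hN : 64 ≤ N) (ha : ‖a‖ ≤ 1.036) (hb : ‖b‖ ≤ 0.28)
    (h : 3 / 5 ≤ N * ‖x‖) : ‖a * jacksonCircle N x + b * jacksonOddCircle N x‖ ≤ 0.1 :=
  (norm_jackson_add_le_of_le_mul_norm hN ha hb (by norm_num) (by norm_num) h).trans (by norm_num)

lemma norm_jackson_add_le_of_one_fourth_le (hN : 64 ≤ N) (ha : ‖a‖ ≤ 1.036) (hb : ‖b‖ ≤ 0.28)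
    (h : 1 / 4 ≤ N * ‖x‖) : ‖a * jacksonCircle N x + b * jacksonOddCircle N x‖ ≤ 0.77 := by
  rcases le_total (2 / 5) (N * ‖x‖) with hfar | hmid
  · exact (norm_jackson_add_le_of_two_fifths_le hN ha hb hfar).trans (by norm_num)
  refine (norm_jackson_add_le (by omega) ha hb (ne_zero_of_le_mul_norm (by norm_num) h)).trans ?_
  rw [← abs_scaledLift] at h hmid
  have heven := jackson_le_mid hN h hmid
  have hodd : |jacksonOdd N (scaledLift N x)| ≤ 0.662 * (2 / 5) :=
    (abs_jacksonOdd_le_mul hN (by linarith)).trans (by gcongr)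
  linarith

lemma norm_jackson_add_le_of_one_le (hN : 64 ≤ N) (ha : ‖a‖ ≤ 1.036) (hb : ‖b‖ ≤ 0.28)
    (h : 1 ≤ N * ‖x‖) :
    ‖a * jacksonCircle N x + b * jacksonOddCircle N x‖ ≤ 0.42 * circleCsc N x ^ 3 := by
  have hcsc := circleCsc_nonneg N x
  have hx := ne_zero_of_le_mul_norm one_pos h
  refine (norm_jackson_add_le_circleCsc (by omega) ha hb hx).trans ?_
  gcongr
  linarith [(circleCsc_le_of_le_one hN one_pos le_rfl h).trans (by norm_num : _ ≤ (0.3185 : ℝ))]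

end Term

lemma IsUnitSeparated.card_le_two (hT : IsUnitSeparated N T) (hx : ∀ t ∈ T, N * ‖x - t‖ < 1) :
    (T.card : ℝ) ≤ 2 := by
  have hcount := hT.sum_natFloor_le x (φ := fun k => if k = 0 then 1 else 0)
    fun k => by split_ifs <;> norm_num
  rw [Finset.sum_congr rfl fun t ht => if_pos (Nat.floor_eq_zero.2 (hx t ht))] at hcount
  simpa using hcount

lemma IsUnitSeparated.three_fifths_le (hT : IsUnitSeparated N T) {s t : Torus} (hs : s ∈ T)
    (ht : t ∈ T.erase s) (hxs : N * ‖x - s‖ ≤ 2 / 5) : 3 / 5 ≤ N * ‖x - t‖ := by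
  have hone := hT.one_le_of_mem_erase hs ht
  have hshift := mul_norm_sub_le_mul_norm (N := N) (c := 2 / 5) (x := s - t) (y := x - t)
    (by rwa [sub_sub_sub_cancel_right])
  linarith

lemma IsUnitSeparated.sum_near_le (hT : IsUnitSeparated N T) (hx : ∀ t ∈ T, N * ‖x - t‖ < 1)
    {f : Torus → ℝ} (hf : ∀ t ∈ T, f t ≤ 0.77)
    (hf₂ : ∀ t ∈ T, 2 / 5 ≤ N * ‖x - t‖ → f t ≤ 0.464)
    (hf₃ : ∀ t ∈ T, 3 / 5 ≤ N * ‖x - t‖ → f t ≤ 0.1) : ∑ t ∈ T, f t ≤ 0.93 := by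
  have hcard := hT.card_le_two hx
  by_cases hex : ∃ s ∈ T, N * ‖x - s‖ ≤ 2 / 5
  · obtain ⟨s, hs, hxs⟩ := hex
    have hothers : ∑ t ∈ T.erase s, f t ≤ (T.erase s).card • 0.1 :=
      Finset.sum_le_card_nsmul _ _ _ fun t ht =>
        hf₃ t (Finset.mem_of_mem_erase ht) (hT.three_fifths_le hs ht hxs)
    rw [Finset.card_erase_of_mem hs, nsmul_eq_mul,
      Nat.cast_pred (Finset.card_pos.2 ⟨s, hs⟩)] at hothers
    rw [← Finset.add_sum_erase T _ hs]
    linarith [hf s hs]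
  · push Not at hex
    have hall : ∑ t ∈ T, f t ≤ T.card • 0.464 :=
      Finset.sum_le_card_nsmul _ _ _ fun t ht => hf₂ t ht (hex t ht).le
    rw [nsmul_eq_mul] at hall
    linarith

lemma IsKernelInterpolation.norm_kernelSum_le_far {v α β : Torus → ℂ}
    (h : IsKernelInterpolation N S v α β) (hS : IsUnitSeparated N S) (hN : 64 ≤ N)
    (hv : ∀ s, ‖v s‖ ≤ 1) (hx : ∀ s ∈ S, 1 / 4 ≤ N * ‖x - s‖) :
    ‖kernelSum N S α β x‖ ≤ 0.97 := by
  set term : Torus → ℝ := fun t =>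
    ‖α t * jacksonCircle N (x - t) + β t * jacksonOddCircle N (x - t)‖
  have hα : ∀ t ∈ S, ‖α t‖ ≤ 1.036 := fun t ht => h.norm_fst_le hv ht
  have hβ := h.norm_snd_le
  have hsep : ∀ p : Torus → Prop, [DecidablePred p] → IsUnitSeparated N (S.filter p) :=
    fun p _ => hS.mono (Finset.filter_subset p S)
  have hfar : ∑ t ∈ S with 1 ≤ N * ‖x - t‖, term t ≤ 0.0353 :=
    calc _ ≤ ∑ t ∈ S with 1 ≤ N * ‖x - t‖, 0.42 * circleCsc N (x - t) ^ 3 :=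
          Finset.sum_le_sum fun t ht => by
            obtain ⟨htS, hone⟩ := Finset.mem_filter.1 ht
            exact norm_jackson_add_le_of_one_le hN (hα t htS) (hβ t htS) hone
      _ = 0.42 * ∑ t ∈ S with 1 ≤ N * ‖x - t‖, circleCsc N (x - t) ^ 3 :=
        (Finset.mul_sum ..).symm
      _ ≤ 0.42 * 0.084 := by
        gcongr
        exact (hsep _).sum_circleCsc_pow_le_of_one_le hN fun t ht => (Finset.mem_filter.1 ht).2
      _ ≤ 0.0353 := by norm_num
  have hnear : ∑ t ∈ S with ¬1 ≤ N * ‖x - t‖, term t ≤ 0.93 := by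
    have hmem : ∀ t ∈ S.filter fun t => ¬1 ≤ N * ‖x - t‖, t ∈ S := fun t ht =>
      Finset.mem_of_mem_filter t ht
    exact (hsep _).sum_near_le (fun t ht => not_le.1 (Finset.mem_filter.1 ht).2)
      (fun t ht => norm_jackson_add_le_of_one_fourth_le hN (hα t (hmem t ht)) (hβ t (hmem t ht))
        (hx t (hmem t ht)))
      (fun t ht => norm_jackson_add_le_of_two_fifths_le hN (hα t (hmem t ht)) (hβ t (hmem t ht)))
      fun t ht => norm_jackson_add_le_of_three_fifths_le hN (hα t (hmem t ht)) (hβ t (hmem t ht))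
  rw [kernelSum_apply]
  calc _ ≤ ∑ t ∈ S, term t := norm_sum_le S _
    _ = _ := (Finset.sum_filter_add_sum_filter_not S (fun t => 1 ≤ N * ‖x - t‖) term).symm
    _ ≤ 0.97 := by linarith

end FarBound

section DualWeight

lemma IsUnitSeparated.exists_dual_polynomial {N : ℕ} {S : Finset Torus}
    (hS : IsUnitSeparated N S) (hN : 64 ≤ N) {v : Torus → ℂ} (hv : ∀ s, ‖v s‖ ≤ 1) :
    ∃ q ∈ trigPoly (2 * (N - 1) + 1), (∀ s ∈ S, q s = v s) ∧
      (∀ s ∈ S, ∀ x, N * ‖x - s‖ ≤ 1 / 4 → ‖q x‖ ≤ 1 - 0.3 * (N * ‖x - s‖) ^ 2) ∧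
      ∀ x, (∀ s ∈ S, 1 / 4 ≤ N * ‖x - s‖) → ‖q x‖ ≤ 0.97 := by
  obtain ⟨α, β, h⟩ := hS.exists_isKernelInterpolation hN hv
  exact ⟨kernelSum N S α β, kernelSum_mem_trigPoly N S α β,
    fun _ hs => h.kernelSum_apply_of_mem hS (by omega) hs,
    fun _ hs _ hx => h.norm_kernelSum_le_near hS hN hv hs hx,
    fun _ hx => h.norm_kernelSum_le_far hS hN hv hx⟩

variable {M : ℕ} {S : Finset Torus}

lemma measurableSet_nearPoint (M : ℕ) (s : Torus) : MeasurableSet (nearPoint M s) :=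
  (isClosed_le (by fun_prop) continuous_const).measurableSet

lemma measurableSet_nearSet (M : ℕ) (S : Finset Torus) : MeasurableSet (nearSet M S) :=
  Finset.measurableSet_biUnion S fun s _ => measurableSet_nearPoint M s

lemma mem_nearSet {x : Torus} : x ∈ nearSet M S ↔ ∃ s ∈ S, x ∈ nearPoint M s := by
  simp only [nearSet, Set.mem_iUnion, exists_prop]

lemma pairwiseDisjoint_nearPoint (hM : 0 < M) (hsep : IsMinSeparated M (S : Set Torus)) :
    Set.PairwiseDisjoint (S : Set Torus) (nearPoint M) := by
  intro s hs t ht hst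
  refine Set.disjoint_left.2 fun x (hxs : dist x s ≤ _) (hxt : dist x t ≤ _) => ?_
  have hlt : 0.16 / (M : ℝ) + 0.16 / M < 2 / M := by
    rw [← add_div]
    gcongr
    norm_num
  linarith [hsep s hs t ht hst, dist_triangle_left s t x]

open Classical in
/-- A lower bound for the gap between `1` and the modulus of the dual polynomials: `0.075 (M d)²`,
with `d` the distance to `S`, on the set `S_M`, and a constant off it. -/
noncomputable def gap (M : ℕ) (S : Finset Torus) (x : Torus) : ℝ :=
  if x ∈ nearSet M S then 0.075 * (M * Metric.infDist x S) ^ 2 else 0.0019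

lemma gap_of_notMem {x : Torus} (hx : x ∉ nearSet M S) : gap M S x = 0.0019 :=
  if_neg hx

lemma gap_of_mem_nearPoint (hsep : IsMinSeparated M (S : Set Torus)) {s x : Torus} (hs : s ∈ S)
    (hx : x ∈ nearPoint M s) : gap M S x = 0.075 * (M * dist x s) ^ 2 := by
  rw [gap, if_pos (mem_nearSet.2 ⟨s, hs, hx⟩)]
  congr 3
  refine le_antisymm (Metric.infDist_le_dist_of_mem (Finset.mem_coe.2 hs))
    ((Metric.le_infDist ⟨s, Finset.mem_coe.2 hs⟩).2 fun t ht => ?_)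
  rcases eq_or_ne s t with rfl | hst
  · exact le_rfl
  · have hle : 0.16 / (M : ℝ) + 0.16 / M ≤ 2 / M := by
      rw [← add_div]
      gcongr
      norm_num
    linarith [show dist x s ≤ _ from hx, hsep s (Finset.mem_coe.2 hs) t ht hst,
      dist_triangle_left s t x]

lemma measurable_gap (M : ℕ) (S : Finset Torus) : Measurable (gap M S) :=
  Measurable.ite (measurableSet_nearSet M S)
    ((((Metric.continuous_infDist_pt _).const_mul _).pow 2).const_mul _).measurable
    measurable_const

lemma gap_nonneg (M : ℕ) (S : Finset Torus) (x : Torus) : 0 ≤ gap M S x := by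
  unfold gap
  split_ifs <;> positivity

lemma le_one_sub_gap {N : ℕ} (hM : 0 < M) (hN : N ≤ M) (hMN : M ≤ 2 * N)
    (hsep : IsMinSeparated M (S : Set Torus)) {f : Torus → ℝ}
    (hnear : ∀ s ∈ S, ∀ x, N * ‖x - s‖ ≤ 1 / 4 → f x ≤ 1 - 0.3 * (N * ‖x - s‖) ^ 2)
    (hfar : ∀ x, (∀ s ∈ S, 1 / 4 ≤ N * ‖x - s‖) → f x ≤ 0.97) (x : Torus) :
    f x ≤ 1 - gap M S x := by
  have hM' : (0 : ℝ) < M := by exact_mod_cast hM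
  have hN' : (N : ℝ) ≤ M := by exact_mod_cast hN
  have hMN' : (M : ℝ) ≤ 2 * N := by exact_mod_cast hMN
  by_cases hx : x ∈ nearSet M S
  · obtain ⟨s, hs, hxs⟩ := mem_nearSet.1 hx
    rw [gap_of_mem_nearPoint hsep hs hxs]
    have hdist : ‖x - s‖ * M ≤ 0.16 := by
      rw [← dist_eq_norm]
      exact (le_div_iff₀ hM').1 hxs
    rw [dist_eq_norm]
    have hscale : (M * ‖x - s‖) ^ 2 ≤ (2 * N * ‖x - s‖) ^ 2 := by gcongr
    exact (hnear s hs x (by nlinarith [norm_nonneg (x - s)])).trans (by nlinarith)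
  · rw [gap_of_notMem hx]
    by_cases hex : ∃ s ∈ S, N * ‖x - s‖ ≤ 1 / 4
    · obtain ⟨s, hs, hxs⟩ := hex
      have hdist : 0.16 < ‖x - s‖ * M := by
        rw [← dist_eq_norm, ← div_lt_iff₀ hM']
        exact not_le.1 fun hle => hx (mem_nearSet.2 ⟨s, hs, hle⟩)
      have hlower : 0.08 ≤ N * ‖x - s‖ := by nlinarith [norm_nonneg (x - s)]
      nlinarith [hnear s hs x hxs]
    · push Not at hex
      linarith [hfar x fun s hs => (hex s hs).le]

lemma IsMinSeparated.isUnitSeparated {N : ℕ} (hsep : IsMinSeparated M (S : Set Torus))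
    (hM : 0 < M) (hMN : M ≤ 2 * N) : IsUnitSeparated N S := fun s hs t ht hst => by
  have hM' : (0 : ℝ) < M := by exact_mod_cast hM
  have hMN' : (M : ℝ) ≤ 2 * N := by exact_mod_cast hMN
  have hle := hsep s hs t ht hst
  rw [dist_eq_norm, div_le_iff₀ hM'] at hle
  nlinarith [norm_nonneg (s - t)]

lemma isDualWeight_gap (hM : 128 ≤ M) (hsep : IsMinSeparated M (S : Set Torus)) :
    IsDualWeight M S (gap M S) where
  measurable := measurable_gap M S
  nonneg := gap_nonneg M S
  exists_interpolant v hv := by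
    obtain ⟨N, hN, hMN⟩ : ∃ N : ℕ, 2 * N ≤ M + 1 ∧ M ≤ 2 * N := ⟨(M + 1) / 2, by omega, by omega⟩
    obtain ⟨q, hq, hqS, hnear, hfar⟩ := (hsep.isUnitSeparated (by omega)
      hMN).exists_dual_polynomial (by omega) fun s => (hv s).le
    exact ⟨q, trigPoly_mono (by omega) hq, hqS,
      le_one_sub_gap (by omega) (by omega) hMN hsep hnear hfar⟩

variable {ν : Measure Torus}

lemma mul_measureReal_compl_nearSet_le (hint : Integrable (gap M S) ν) :
    0.0019 * ν.real (nearSet M S)ᶜ ≤ ∫ x, gap M S x ∂ν :=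
  calc 0.0019 * ν.real (nearSet M S)ᶜ = ∫ x in (nearSet M S)ᶜ, gap M S x ∂ν := by
        rw [setIntegral_congr_fun (measurableSet_nearSet M S).compl fun x => gap_of_notMem,
          setIntegral_const, smul_eq_mul, mul_comm]
    _ ≤ ∫ x, gap M S x ∂ν :=
      setIntegral_le_integral hint (Filter.Eventually.of_forall (gap_nonneg M S))

lemma mul_sum_setIntegral_dist_sq_le (hM : 0 < M) (hsep : IsMinSeparated M (S : Set Torus))
    (hint : Integrable (gap M S) ν) :
    0.075 * (M : ℝ) ^ 2 * ∑ s ∈ S, ∫ x in nearPoint M s, dist x s ^ 2 ∂ν ≤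
      ∫ x, gap M S x ∂ν :=
  calc _ = ∑ s ∈ S, ∫ x in nearPoint M s, gap M S x ∂ν := by
        rw [Finset.mul_sum]
        refine Finset.sum_congr rfl fun s hs => ?_
        rw [← integral_const_mul]
        refine setIntegral_congr_fun (measurableSet_nearPoint M s) fun x hx => ?_
        rw [gap_of_mem_nearPoint hsep hs hx]
        ring
    _ = ∫ x in nearSet M S, gap M S x ∂ν :=
      (integral_biUnion_finset S (fun s _ => measurableSet_nearPoint M s)
        (pairwiseDisjoint_nearPoint hM hsep) fun _ _ => hint.integrableOn).symm
    _ ≤ ∫ x, gap M S x ∂ν :=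
      setIntegral_le_integral hint (Filter.Eventually.of_forall (gap_nonneg M S))

end DualWeight

end SuperResolution

theorem proposition2 :
    ∃ C : ℝ, 0 < C ∧
      ∀ (M : ℕ) (ε : ℝ) (μ₀ μ : MeasureTheory.ComplexMeasure SuperResolution.Torus)
        (S : Finset SuperResolution.Torus),
        128 ≤ M →
        μ₀ ∈ SuperResolution.separatedMeasures M →
        (S : Set SuperResolution.Torus) = SuperResolution.support μ₀ →
        SuperResolution.IsApproximation ε M μ μ₀ →
          (μ - μ₀).variation.real (SuperResolution.nearSet M S)ᶜ ≤ C * ε ∧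
          ∑ s ∈ S, ∫ x in SuperResolution.nearPoint M s, dist x s ^ 2 ∂(μ - μ₀).variation
            ≤ C * ((M : ℝ) ^ 2)⁻¹ * ε := by
  open SuperResolution in
  refine ⟨2200, by norm_num, fun M ε μ₀ μ S hM hμ₀ hS happ => ?_⟩
  have hsep : IsMinSeparated M (S : Set Torus) := hS ▸ hμ₀.2
  have : (0 : ℝ) < M := by exact_mod_cast (by omega : 0 < M)
  have hε : 0 ≤ 2 * ε := ENNReal.toReal_nonneg.trans happ.2
  have hgap := isDualWeight_gap hM hsep
  have hle := hgap.integral_le hS happ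
  have hint := hgap.integrable (μ - μ₀).variation
  have hfar := mul_measureReal_compl_nearSet_le hint
  have hnear := mul_sum_setIntegral_dist_sq_le (by omega) hsep hint
  refine ⟨by linarith, ?_⟩
  rw [mul_right_comm, ← div_eq_mul_inv, le_div_iff₀ (by positivity)]
  linarith
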